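/- Let $S=\mathbf{C}\cup\{\infty\}$ be the Riemann sphere, let $n\ge 1$, $n\ne 2$, and let $a_1,\dots,a_n\in S$ be distinct points. Let $\alpha_1,\dots,\alpha_n$ be positive real numbers with $\alpha_j\neq 1$. Suppose that $S\setminus\{a_1,\dots,a_n\}$ carries a conformal Riemannian metric of constant curvature $1$ with conic singularities at the points $a_j$ of angles $2\pi\alpha_j$ (that is, in a local conformal coordinate $z$ vanishing at $a_j$ the length element is $\rho(z)|dz|$, where $\rho(z)/|z|^{\alpha_j-1}$ has a positive finite limit as $z\to0$). Suppose that the metric is co-axial: it has a developing map (a multi-valued analytic local isometry $f$ from $S\setminus\{a_1,\dots,a_n\}$ to $\mathbf{C}\cup\{\infty\}$ with the standard metric $2|dw|/(1+|w|^2)$, which can be continued analytically along every curve avoiding the $a_j$) such that the continuation of $f$ along every closed path multiplies $f$ by a constant of absolute value $1$. Then at least one of the $\alpha_j$ is an integer, and there exist signs $\epsilon_j\in\{\pm1\}$ and a non-negative integer $k'$ such that $$\sum_{j:\,\alpha_j\notin\mathbf{Z}}\epsilon_j\alpha_j=k',\qquad \sum_{j:\,\alpha_j\in\mathbf{Z}}\alpha_j\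 \ge\ n+k'-2,\qquad \sum_{j:\,\alpha_j\in\mathbf{Z}}\alpha_j\ \equiv\ n+k' \pmod 2.$$ -/

import Mathlib

open Filter Topology Set
open scoped ContDiff unitInterval

/-! ### The Riemann sphere and conformal metrics on it

The Riemann sphere is `OnePoint ℂ`. It carries the coordinate `z` on `ℂ` and the coordinate
`w = 1 / z` near `∞`. -/

/-- The (inverse of the) standard local conformal coordinate of the Riemann sphere which
equals `0` at `p`: it is `w ↦ p + w` for `p ∈ ℂ`, and `w ↦ 1 / w` for `p = ∞`. -/
noncomputable def sphereCoord : OnePoint ℂ → ℂ → OnePoint ℂ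
  | OnePoint.infty, w => open Classical in
      if w = 0 then OnePoint.infty else ((w⁻¹ : ℂ) : OnePoint ℂ)
  | OnePoint.some p, w => ((p + w : ℂ) : OnePoint ℂ)

/-- The data of a conformal metric on (a subset of) the Riemann sphere: the length element is
`dens z * |dz|` in the coordinate `z`, and `densInfty w * |dw|` in the coordinate `w = 1 / z`.
Positivity and smoothness away from the singularities are required in `IsSphericalConeMetric`;
the values of the densities at the singularities are irrelevant. -/
structure ConformalMetric where
  /-- the density in the coordinate `z` -/
  dens : ℂ → ℝ
  /-- the density in the coordinate `w = 1 / z` -/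
  densInfty : ℂ → ℝ
  /-- since `|dz| = |dw| / |w|^2` -/
  compat : ∀ w : ℂ, w ≠ 0 → densInfty w = dens w⁻¹ / ‖w‖ ^ 2

/-- The density of the metric in the coordinate `sphereCoord p` centered at `p`. -/
def ConformalMetric.localDens (g : ConformalMetric) : OnePoint ℂ → ℂ → ℝ
  | OnePoint.infty, w => g.densInfty w
  | OnePoint.some p, w => g.dens (p + w)

/-- The Gaussian curvature `-(Δ log ρ) / ρ²` of the conformal metric `ρ(w) |dw|`. -/
noncomputable def gaussianCurvature (ρ : ℂ → ℝ) (w : ℂ) : ℝ :=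
  -(Laplacian.laplacian (fun z : ℂ => Real.log (ρ z)) w) / ρ w ^ 2

/-- `g` is a smooth Riemannian metric of constant curvature `1` on the Riemann sphere minus the
points `a j`, with a conic singularity of angle `α j` turns (that is, `2 π α j` radians) at
`a j` for every `j`. -/
structure IsSphericalConeMetric {n : ℕ} (g : ConformalMetric) (a : Fin n → OnePoint ℂ)
    (α : Fin n → ℝ) : Prop where
  pos : ∀ p, p ∉ range a → 0 < g.localDens p 0
  smooth : ∀ p, p ∉ range a → ContDiffAt ℝ ∞ (g.localDens p) 0
  curvature : ∀ p, p ∉ range a → gaussianCurvature (g.localDens p) 0 = 1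
  conic : ∀ j, ∃ c : ℝ, 0 < c ∧
    Tendsto (fun w : ℂ => g.localDens (a j) w / ‖w‖ ^ (α j - 1)) (𝓝[≠] 0) (𝓝 c)

/-! ### The developing map and its monodromy

Holomorphic maps to the sphere are represented by meromorphic functions; since the value of a
meromorphic function at a pole carries no information, germs at `p` are compared on punctured
neighborhoods of `p`. The target is the sphere with the standard metric
`2 |df| / (1 + |f|²)`. -/

/-- `f` is, near `p`, an analytic local isometry from the metric `g` to the standard sphere. -/
def IsLocalIsometryAt (g : ConformalMetric) (f : OnePoint ℂ → ℂ) (p : OnePoint ℂ) : Prop :=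
  MeromorphicAt (fun w => f (sphereCoord p w)) 0 ∧
  ∀ᶠ w in 𝓝[≠] (0 : ℂ),
    2 * ‖deriv (fun w => f (sphereCoord p w)) w‖ / (1 + ‖f (sphereCoord p w)‖ ^ 2)
      = g.localDens p w

/-- `F t` is the germ at `γ t` of the analytic continuation, by local isometries, along the
curve `γ` of the germ of `F 0` at `p`. -/
def IsContinuationAlong (g : ConformalMetric) {p q : OnePoint ℂ} (γ : Path p q)
    (F : I → OnePoint ℂ → ℂ) : Prop :=
  ∀ t : I, IsLocalIsometryAt g (F t) (γ t) ∧ ∀ᶠ s in 𝓝 t, F s =ᶠ[𝓝[≠] (γ s)] F t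

/-- The germ of `f` at the nonsingular point `p` is a germ of a developing map of the metric `g`
with singular set `P`: it is an isometry to the standard sphere and it can be continued along
every curve from `p` that avoids `P`. -/
structure IsDevelopingMap (g : ConformalMetric) (P : Set (OnePoint ℂ)) (p : OnePoint ℂ)
    (f : OnePoint ℂ → ℂ) : Prop where
  base : p ∉ P
  isometry : IsLocalIsometryAt g f p
  continuation : ∀ (q : OnePoint ℂ) (γ : Path p q), (∀ t, γ t ∉ P) →
    ∃ F, IsContinuationAlong g γ F ∧ F 0 =ᶠ[𝓝[≠] p] f

/-- The metric `g` with singular set `P` is co-axial: it has a developing map `f` (developing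
maps are determined up to rotations of the target sphere) whose monodromy group is contained in
the unit circle, that is, for every closed path in the complement of `P` the result of the
continuation of `f` along it is `c * f` with `|c| = 1`. -/
def IsCoaxial (g : ConformalMetric) (P : Set (OnePoint ℂ)) : Prop :=
  ∃ (p : OnePoint ℂ) (f : OnePoint ℂ → ℂ), IsDevelopingMap g P p f ∧
    ∀ γ : Path p p, (∀ t, γ t ∉ P) →
      ∀ F, IsContinuationAlong g γ F → F 0 =ᶠ[𝓝[≠] p] f →
        ∃ c : ℂ, ‖c‖ = 1 ∧ F 1 =ᶠ[𝓝[≠] p] fun z => c * f z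

open Classical in
/-- The indices of the integer angles. -/
noncomputable def integerAngles {n : ℕ} (α : Fin n → ℝ) : Finset (Fin n) :=
  Finset.univ.filter fun j => ∃ k : ℤ, α j = k

/-!
A developing map `f` of a co-axial metric is multi-valued, but its monodromy consists of rotations
`f ↦ c f` about the axis through `0` and `∞`. Hence the vector field `w ∂/∂w`, which is invariant
under these rotations of the target sphere, pulls back to a single-valued holomorphic vector field
`k = f / f'` on the complement of the singularities, and the height along the axis pulls back to a
single-valued real function `x = (1 - |f|²) / (1 + |f|²)`. This is `IsCoaxial.exists_isRotationFieldAt`;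
the pair is described, without reference to `f`, by `IsRotationFieldAt`.

The length `√(1 - x²)` of the field is at most `1`, so that `k` is meromorphic at a cone point of angle
`2 π α`; moreover `x` has a limit there. If this limit is not `±1`, comparison of lengths shows that `k`
has order `1 - α`, and `α` is an integer. Otherwise the growth of `log (1 - x²)` on rays and the critical
points of `x` on circles show that `k` has a simple zero and that the dual form `dz / k = df / f` has
residue `±α` (`IsRotationFieldAt.exists_order`). A nonsingular point behaves like a cone point with
`α = 1`, so one local statement covers all points of the sphere, including infinity.

Globally, `k` is a meromorphic vector field on the sphere: its orders add up to `2`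
(`sum_order_eq_two`) and the residues of `dz / k` add up to `0` (`sum_residue_eq_zero`). With `N` simple
zeros at nonsingular points, which have residues `±1`, these two relations express the signed sum of the
nonintegral angles as an integer and the sum of the integral angles as `n - 2 + N` plus the integral
angles that occur as residues; the theorem follows by elementary arithmetic (`angle_relations`).
-/

/-! ### The rotation field of a local isometry -/

/-- A property that holds on a punctured neighborhood of `q` holds on punctured neighborhoods of all
points near `q`, including `q` itself. -/
theorem eventually_eventually_nhdsNE {X : Type*} [TopologicalSpace X] [T1Space X] {q : X}
    {P : X → Prop} (h : ∀ᶠ y in 𝓝[≠] q, P y) : ∀ᶠ q' in 𝓝 q, ∀ᶠ y in 𝓝[≠] q', P y := by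
  rw [eventually_nhdsWithin_iff] at h
  filter_upwards [eventually_eventually_nhds.2 h] with q' hq'
  by_cases hq : q' = q
  · subst hq
    exact eventually_nhdsWithin_iff.2 hq'
  · refine Eventually.filter_mono nhdsWithin_le_nhds ?_
    filter_upwards [hq', isOpen_ne.mem_nhds hq] with y h1 h2 using h1 h2

/-- Near `z`, the holomorphic vector field `k ∂/∂z` and the real function `x` look like the pullback,
under a local isometry `φ` from the metric `ρ |dz|` to the unit sphere, of the field `w ∂/∂w` and
of the height along the axis through `0` and `∞`: `k = φ / φ'` and `x = (1 - |φ|²) / (1 + |φ|²)`. It is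
called a rotation field since its multiple by the imaginary unit generates the rotations about that
axis. The conditions recorded here no longer mention `φ`: the field has length `√(1 - x²)`, and it is
the negative of the Riemannian gradient of `x`, whose Euclidean gradient is thus `-ρ² k`. The pair
`(-k, -x)` corresponds to `1 / φ`. -/
structure IsRotationFieldAt (ρ : ℂ → ℝ) (k : ℂ → ℂ) (x : ℂ → ℝ) (z : ℂ) : Prop where
  pos : 0 < ρ z
  analyticAt : AnalyticAt ℂ k z
  eventually_ne : ∀ᶠ w in 𝓝[≠] z, k w ≠ 0
  sq_add_sq : (ρ z * ‖k z‖) ^ 2 + x z ^ 2 = 1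
  hasFDerivAt : HasFDerivAt x (-(ρ z ^ 2) • innerSL ℝ (k z)) z

section

namespace IsRotationFieldAt

variable {ρ ρ' x x' : ℂ → ℝ} {k k' : ℂ → ℂ} {z : ℂ}

theorem neg (h : IsRotationFieldAt ρ k x z) :
    IsRotationFieldAt ρ (fun w => -k w) (fun w => -x w) z where
  pos := h.pos
  analyticAt := h.analyticAt.neg
  eventually_ne := by simpa using h.eventually_ne
  sq_add_sq := by simpa using h.sq_add_sq
  hasFDerivAt := by
    refine h.hasFDerivAt.neg.congr_fderiv ?_
    ext v
    simp

theorem congr (h : IsRotationFieldAt ρ k x z) (hρ : ρ z = ρ' z) (hk : k =ᶠ[𝓝 z] k')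
    (hx : x =ᶠ[𝓝 z] x') : IsRotationFieldAt ρ' k' x' z where
  pos := hρ ▸ h.pos
  analyticAt := h.analyticAt.congr hk
  eventually_ne := by
    filter_upwards [h.eventually_ne, hk.filter_mono nhdsWithin_le_nhds] with w h1 h2
    rwa [← h2]
  sq_add_sq := by rw [← hρ, ← hk.eq_of_nhds, ← hx.eq_of_nhds]; exact h.sq_add_sq
  hasFDerivAt := by
    rw [← hρ, ← hk.eq_of_nhds]
    exact h.hasFDerivAt.congr_of_eventuallyEq hx.symm

/-- The structure is invariant under a holomorphic change of coordinate: `ρ` transforms as a length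
element, `k` as the component of a vector field and `x` as a function. -/
theorem comp {τ : ℂ → ℂ} (h : IsRotationFieldAt ρ k x (τ z)) (hτ : AnalyticAt ℂ τ z)
    (hd : deriv τ z ≠ 0) :
    IsRotationFieldAt (fun w => ρ (τ w) * ‖deriv τ w‖) (fun w => k (τ w) / deriv τ w)
      (fun w => x (τ w)) z where
  pos := mul_pos h.pos (norm_pos_iff.2 hd)
  analyticAt := (h.analyticAt.comp hτ).div hτ.deriv hd
  eventually_ne := by
    have h1 : ∀ᶠ w in 𝓝[≠] z, deriv τ w ≠ 0 :=
      (hτ.deriv.continuousAt.eventually_ne hd).filter_mono nhdsWithin_le_nhds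
    have h2 : Tendsto τ (𝓝[≠] z) (𝓝[≠] (τ z)) :=
      hτ.differentiableAt.hasDerivAt.tendsto_nhdsNE hd
    filter_upwards [h1, h2.eventually h.eventually_ne] with w a b using div_ne_zero b a
  sq_add_sq := by
    have h2 := norm_ne_zero_iff.2 hd
    rw [norm_div, mul_assoc, mul_div_cancel₀ _ h2]
    exact h.sq_add_sq
  hasFDerivAt := by
    have h1 := hτ.differentiableAt.hasDerivAt.hasFDerivAt.restrictScalars ℝ
    refine (h.hasFDerivAt.comp z h1).congr_fderiv ?_
    ext v
    have h2 := norm_ne_zero_iff.2 hd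
    have key : (inner ℝ (k (τ z)) (v * deriv τ z) : ℝ)
        = inner ℝ (k (τ z) / deriv τ z) v * ‖deriv τ z‖ ^ 2 := by
      symm
      simp only [Complex.inner]
      rw [Complex.sq_norm, ← Complex.re_mul_ofReal, Complex.normSq_eq_conj_mul_self]
      congr 1
      have : (starRingEnd ℂ) (deriv τ z) ≠ 0 := by simpa using hd
      rw [map_div₀]
      field_simp
    have e1 : (innerSL ℝ (k (τ z))) (v * deriv τ z) = _ := key
    simp [e1]
    ring

theorem mul_norm_le_one (h : IsRotationFieldAt ρ k x z) : ρ z * ‖k z‖ ≤ 1 := by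
  nlinarith [h.sq_add_sq, sq_nonneg (x z)]

theorem abs_le_one (h : IsRotationFieldAt ρ k x z) : |x z| ≤ 1 := by
  rw [abs_le]
  constructor <;> nlinarith [h.sq_add_sq, sq_nonneg (ρ z * ‖k z‖)]

/-- The derivative of `x` along a curve. -/
theorem hasDerivAt_comp (h : IsRotationFieldAt ρ k x z) {γ : ℝ → ℂ} {t : ℝ} {v : ℂ}
    (hγ : HasDerivAt γ v t) (hz : γ t = z) :
    HasDerivAt (fun s => x (γ s)) (-(ρ z ^ 2) * (starRingEnd ℂ (k z) * v).re) t := by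
  subst hz
  have := h.hasFDerivAt.comp_hasDerivAt t hγ
  refine this.congr_deriv ?_
  simp [Complex.inner]
  exact Or.inl (by ring)

end IsRotationFieldAt

end

theorem isRotationFieldAt_of_analyticAt {ρ : ℂ → ℝ} {ψ : ℂ → ℂ} {z : ℂ} (hψ : AnalyticAt ℂ ψ z)
    (hd : deriv ψ z ≠ 0) (hρ : 2 * ‖deriv ψ z‖ / (1 + ‖ψ z‖ ^ 2) = ρ z) :
    IsRotationFieldAt ρ (fun w => ψ w / deriv ψ w)
      (fun w => (1 - ‖ψ w‖ ^ 2) / (1 + ‖ψ w‖ ^ 2)) z where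
  pos := by
    rw [← hρ]
    have := norm_pos_iff.2 hd
    positivity
  analyticAt := hψ.div hψ.deriv hd
  eventually_ne := by
    have h1 : ∀ᶠ w in 𝓝[≠] z, deriv ψ w ≠ 0 :=
      (hψ.deriv.continuousAt.eventually_ne hd).filter_mono nhdsWithin_le_nhds
    have h2 : ∀ᶠ w in 𝓝[≠] z, ψ w ≠ 0 := by
      refine hψ.eventually_eq_zero_or_eventually_ne_zero.resolve_left fun h0 => hd ?_
      rw [EventuallyEq.deriv_eq (f := fun _ => 0) h0]
      simp
    filter_upwards [h1, h2] with w a b using div_ne_zero b a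
  sq_add_sq := by
    have h1 : 1 + ‖ψ z‖ ^ 2 ≠ 0 := by positivity
    have h2 := norm_ne_zero_iff.2 hd
    rw [← hρ, norm_div]
    field_simp
    ring
  hasFDerivAt := by
    have h1 : 1 + ‖ψ z‖ ^ 2 ≠ 0 := by positivity
    have hN := (hψ.differentiableAt.hasDerivAt.hasFDerivAt.restrictScalars ℝ).norm_sq
    have hg : HasDerivAt (fun t : ℝ => (1 - t) / (1 + t)) (-2 / (1 + ‖ψ z‖ ^ 2) ^ 2) (‖ψ z‖ ^ 2) := by
      refine (((hasDerivAt_id _).const_sub 1).div ((hasDerivAt_id _).const_add 1) h1).congr_deriv ?_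
      ring
    refine (hg.comp_hasFDerivAt z hN).congr_fderiv ?_
    ext v
    have key : (inner ℝ (ψ z / deriv ψ z) v : ℝ) * ‖deriv ψ z‖ ^ 2
        = inner ℝ (ψ z) (v * deriv ψ z) := by
      simp only [Complex.inner]
      rw [Complex.sq_norm, ← Complex.re_mul_ofReal, Complex.normSq_eq_conj_mul_self]
      congr 1
      have : (starRingEnd ℂ) (deriv ψ z) ≠ 0 := by simpa using hd
      rw [map_div₀]
      field_simp
    have hd' := norm_ne_zero_iff.2 hd
    have e1 : (innerSL ℝ (ψ z)) (v * deriv ψ z)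
        = (inner ℝ (ψ z / deriv ψ z) v : ℝ) * ‖deriv ψ z‖ ^ 2 := key.symm
    rw [← hρ]
    simp [e1]
    field_simp

/-- A meromorphic local isometry `φ` gives rise to a rotation field; this field is holomorphic
even at the zeros and poles of `φ`. -/
theorem MeromorphicAt.exists_isRotationFieldAt {ρ : ℂ → ℝ} {φ : ℂ → ℂ} {z : ℂ} (hφ : MeromorphicAt φ z)
    (hρ : ContinuousAt ρ z) (hpos : 0 < ρ z)
    (hiso : ∀ᶠ w in 𝓝[≠] z, 2 * ‖deriv φ w‖ / (1 + ‖φ w‖ ^ 2) = ρ w) :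
    ∃ (k : ℂ → ℂ) (x : ℂ → ℝ), (∀ᶠ w in 𝓝[≠] z, φ w / deriv φ w = k w) ∧
      (∀ᶠ w in 𝓝[≠] z, (1 - ‖φ w‖ ^ 2) / (1 + ‖φ w‖ ^ 2) = x w) ∧
      ∀ᶠ w in 𝓝 z, IsRotationFieldAt ρ k x w := by
  -- at a pole, pass to `1 / φ`, which changes the signs of `k` and `x`
  wlog h0 : 0 ≤ meromorphicOrderAt φ z generalizing φ
  · have hne : ∀ᶠ w in 𝓝[≠] z, φ w ≠ 0 := by
      rw [← meromorphicOrderAt_ne_top_iff_eventually_ne_zero hφ]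
      exact (not_le.1 h0).ne_top
    have hd : ∀ᶠ w in 𝓝[≠] z, deriv φ⁻¹ w = -deriv φ w / φ w ^ 2 := by
      filter_upwards [hne, hφ.eventually_analyticAt] with w h1 h2
      exact (h2.differentiableAt.hasDerivAt.inv h1).deriv
    have hd0 : ∀ᶠ w in 𝓝[≠] z, 0 < ρ w :=
      (hρ.eventually_const_lt hpos).filter_mono nhdsWithin_le_nhds
    obtain ⟨k, x, hk, hx, h⟩ := this (φ := φ⁻¹) hφ.inv (by
        filter_upwards [hne, hd, hiso] with w h1 h2 h3
        have := norm_ne_zero_iff.2 h1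
        rw [h2, ← h3, Pi.inv_apply, norm_div, norm_neg, norm_inv, norm_pow]
        field_simp
        ring) (by
        rw [meromorphicOrderAt_inv]
        have h0' := not_le.1 h0
        lift meromorphicOrderAt φ z to ℤ using h0'.ne_top with m
        norm_cast at *
        omega)
    refine ⟨fun w => -k w, fun w => -x w, ?_, ?_, h.mono fun w hw => hw.neg⟩
    · filter_upwards [hne, hk, hd, hiso, hd0] with w h1 h2 h3 h4 h5
      have h6 : deriv φ w ≠ 0 := by
        rintro h
        simp [h] at h4
        linarith
      rw [← h2, h3, Pi.inv_apply]
      field_simp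
    · filter_upwards [hne, hx] with w h1 h2
      have := norm_ne_zero_iff.2 h1
      rw [← h2, Pi.inv_apply, norm_inv]
      field_simp
      ring
  obtain ⟨ψ, hψ, hψφ⟩ : ∃ ψ, AnalyticAt ℂ ψ z ∧ φ =ᶠ[𝓝[≠] z] ψ :=
    (hφ.meromorphicOrderAt_nonneg_iff).1 h0
  have hd : deriv φ =ᶠ[𝓝[≠] z] deriv ψ := hψφ.nhdsNE_deriv
  have hρψ : ∀ᶠ w in 𝓝[≠] z, 2 * ‖deriv ψ w‖ / (1 + ‖ψ w‖ ^ 2) = ρ w := by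
    filter_upwards [hiso, hd, hψφ] with w h1 h2 h3
    rw [← h2, ← h3, h1]
  have hcont : ContinuousAt (fun w => 2 * ‖deriv ψ w‖ / (1 + ‖ψ w‖ ^ 2)) z :=
    (continuousAt_const.mul hψ.deriv.continuousAt.norm).div
      (continuousAt_const.add (hψ.continuousAt.norm.pow 2)) (by positivity)
  have hz : 2 * ‖deriv ψ z‖ / (1 + ‖ψ z‖ ^ 2) = ρ z :=
    tendsto_nhds_unique (hcont.tendsto.mono_left nhdsWithin_le_nhds)
      ((hρ.tendsto.mono_left nhdsWithin_le_nhds).congr' (hρψ.mono fun w hw => hw.symm))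
  have hρψ' : ∀ᶠ w in 𝓝 z, 2 * ‖deriv ψ w‖ / (1 + ‖ψ w‖ ^ 2) = ρ w := by
    rw [eventually_nhdsWithin_iff] at hρψ
    filter_upwards [hρψ] with w hw
    by_cases h : w = z
    · rw [h, hz]
    · exact hw h
  refine ⟨fun w => ψ w / deriv ψ w, fun w => (1 - ‖ψ w‖ ^ 2) / (1 + ‖ψ w‖ ^ 2), ?_, ?_, ?_⟩
  rotate_left 2
  · filter_upwards [hψ.eventually_analyticAt, hρψ', hρ.eventually_const_lt hpos] with w h1 h2 h3
    refine isRotationFieldAt_of_analyticAt h1 ?_ h2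
    intro h
    simp [h] at h2
    linarith
  · filter_upwards [hψφ, hd] with w h1 h2
    rw [h1, h2]
  · filter_upwards [hψφ] with w h1
    rw [h1]

/-! ### Analytic continuation and the rotation field of a co-axial metric -/

theorem OnePoint.nhdsNE_coe {X : Type*} [TopologicalSpace X] (x : X) :
    𝓝[≠] (x : OnePoint X) = map (↑) (𝓝[≠] x) := by
  rw [OnePoint.nhdsWithin_coe]
  congr 2
  ext y
  simp

theorem map_sphereCoord_nhdsNE (q : OnePoint ℂ) : map (sphereCoord q) (𝓝[≠] 0) = 𝓝[≠] q := by
  induction q using OnePoint.rec with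
  | infty =>
    have h : sphereCoord OnePoint.infty =ᶠ[𝓝[≠] 0] fun w => ((w⁻¹ : ℂ) : OnePoint ℂ) := by
      filter_upwards [self_mem_nhdsWithin] with w hw
      simp only [sphereCoord]
      exact if_neg hw
    rw [map_congr h, OnePoint.nhdsNE_infty_eq, coclosedCompact_eq_cocompact,
      ← Metric.cobounded_eq_cocompact, ← Filter.inv_nhdsNE_zero]
    rfl
  | coe z =>
    have h : sphereCoord (z : OnePoint ℂ) = (fun w : ℂ => (w : OnePoint ℂ)) ∘ (z + ·) := rfl
    have h2 : map (z + ·) (𝓝[≠] (0 : ℂ)) = 𝓝[≠] z := by simp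
    rw [h, ← map_map, h2, OnePoint.nhdsNE_coe]

section

variable {g : ConformalMetric} {P : Set (OnePoint ℂ)} {p q : OnePoint ℂ} {f φ ψ : OnePoint ℂ → ℂ}

/-- Identity theorem for germs. -/
theorem IsLocalIsometryAt.eventuallyEq_or_ne (hφ : IsLocalIsometryAt g φ q)
    (hψ : IsLocalIsometryAt g ψ q) : φ =ᶠ[𝓝[≠] q] ψ ∨ ∀ᶠ y in 𝓝[≠] q, φ y ≠ ψ y := by
  rw [EventuallyEq, ← map_sphereCoord_nhdsNE, eventually_map, eventually_map]
  simpa [sub_eq_zero] using (hφ.1.sub hψ.1).eventually_eq_zero_or_eventually_ne_zero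

theorem IsLocalIsometryAt.const_mul (hφ : IsLocalIsometryAt g φ q) {c : ℂ} (hc : ‖c‖ = 1) :
    IsLocalIsometryAt g (fun y => c * φ y) q := by
  refine ⟨(MeromorphicAt.const c 0).mul hφ.1, ?_⟩
  filter_upwards [hφ.2] with w hw
  rw [deriv_const_mul_field, norm_mul, norm_mul, hc, one_mul, one_mul]
  exact hw

theorem isLocalIsometryAt_coe {z : ℂ} : IsLocalIsometryAt g φ z ↔
    MeromorphicAt (fun w : ℂ => φ w) z ∧ ∀ᶠ w : ℂ in 𝓝[≠] z,
      2 * ‖deriv (fun w : ℂ => φ w) w‖ / (1 + ‖φ w‖ ^ 2) = g.dens w := by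
  have h : 𝓝[≠] z = map (z + ·) (𝓝[≠] (0 : ℂ)) := by simp
  rw [h, eventually_map]
  refine and_congr ?_ ?_
  · have := meromorphicAt_comp_add_const_iff_meromorphicAt (c := z) (f := fun w : ℂ => φ w) (x := 0)
    rw [zero_add] at this
    rw [← this]
    simp only [sphereCoord, Function.comp_def, add_comm]
  · simp_rw [← deriv_comp_const_add]
    rfl

theorem IsLocalIsometryAt.eventually {z : ℂ} (hφ : IsLocalIsometryAt g φ z) :
    ∀ᶠ w : ℂ in 𝓝 z, IsLocalIsometryAt g φ w := by
  have h1 := isLocalIsometryAt_coe.1 hφ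
  have h2 : ∀ᶠ w in 𝓝 z, MeromorphicAt (fun w : ℂ => φ w) w := by
    have := h1.1.eventually_analyticAt
    rw [eventually_nhdsWithin_iff] at this
    filter_upwards [this] with w hw
    by_cases h : w = z
    · exact h ▸ h1.1
    · exact (hw h).meromorphicAt
  filter_upwards [h2, eventually_eventually_nhdsNE h1.2] with w a b
  exact isLocalIsometryAt_coe.2 ⟨a, b⟩

/-- Uniqueness of analytic continuation along a curve: the set of times at which the germs agree is
open and closed. -/
theorem IsContinuationAlong.unique {γ : Path p q} {F G : I → OnePoint ℂ → ℂ}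
    (hF : IsContinuationAlong g γ F) (hG : IsContinuationAlong g γ G)
    (h0 : F 0 =ᶠ[𝓝[≠] p] G 0) (t : I) : F t =ᶠ[𝓝[≠] (γ t)] G t := by
  let S : Set I := {t | F t =ᶠ[𝓝[≠] (γ t)] G t}
  have key : ∀ t, ∀ᶠ s in 𝓝 t, s ∈ S ↔ t ∈ S := by
    intro t
    have hP : ∀ {Q : OnePoint ℂ → Prop}, (∀ᶠ y in 𝓝[≠] (γ t), Q y) →
        ∀ᶠ s in 𝓝 t, ∀ᶠ y in 𝓝[≠] (γ s), Q y := fun h =>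
      γ.continuous.continuousAt.eventually (eventually_eventually_nhdsNE h)
    rcases (hF t).1.eventuallyEq_or_ne (hG t).1 with h | h
    · filter_upwards [(hF t).2, (hG t).2, hP h] with s h1 h2 h3
      exact iff_of_true ((h1.trans h3).trans h2.symm) h
    · filter_upwards [(hF t).2, (hG t).2, hP h] with s h1 h2 h3
      refine iff_of_false (fun h4 => ?_) fun h4 => ?_
      · obtain ⟨y, hy1, hy2⟩ := (((h1.symm.trans h4).trans h2).and h3).exists
        exact hy2 hy1
      · obtain ⟨y, hy1, hy2⟩ := (Eventually.and (show F t =ᶠ[𝓝[≠] (γ t)] G t from h4) h).exists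
        exact hy2 hy1
  have hS : IsClopen S := by
    refine ⟨⟨isOpen_iff_mem_nhds.2 fun t ht => ?_⟩, isOpen_iff_mem_nhds.2 fun t ht => ?_⟩
    · filter_upwards [key t] with s hs using fun h => ht (hs.1 h)
    · filter_upwards [key t] with s hs using hs.2 ht
  have : S = univ := hS.eq_univ ⟨0, by simpa [S] using h0⟩
  exact (Set.eq_univ_iff_forall.1 this t :)

/-- A continuation can be restricted to a part of the curve, or traversed backwards. -/
theorem IsContinuationAlong.comp {p' q' : OnePoint ℂ} {γ : Path p q} {γ' : Path p' q'}
    {F : I → OnePoint ℂ → ℂ} (hF : IsContinuationAlong g γ F) {s : I → I} (hs : Continuous s)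
    (h : ∀ t, γ (s t) = γ' t) : IsContinuationAlong g γ' (F ∘ s) := by
  intro t
  rw [← h]
  refine ⟨(hF (s t)).1, ?_⟩
  filter_upwards [hs.continuousAt.eventually (hF (s t)).2] with u hu
  rw [← h]
  exact hu

/-- The map `t ↦ t / 2` of the unit interval. -/
noncomputable def unitInterval.halve (t : I) : I :=
  ⟨t / 2, by constructor <;> linarith [t.2.1, t.2.2]⟩

theorem unitInterval.continuous_halve : Continuous unitInterval.halve := by
  unfold unitInterval.halve
  fun_prop

theorem Path.trans_halve {r : OnePoint ℂ} (γ : Path p q) (γ' : Path q r) (t : I) :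
    γ.trans γ' (unitInterval.halve t) = γ t := by
  rw [Path.trans_apply, dif_pos (by simp only [unitInterval.halve]; linarith [t.2.2])]
  congr 1
  ext
  simp [unitInterval.halve]
  ring

theorem Path.trans_symm_halve {r : OnePoint ℂ} (γ : Path p q) (γ' : Path q r) (t : I) :
    γ.trans γ' (unitInterval.symm (unitInterval.halve t)) = γ' (unitInterval.symm t) := by
  have := Path.trans_halve γ'.symm γ.symm t
  rwa [← Path.trans_symm, Path.symm_apply] at this

/-- `φ` represents the germ at `q` of a continuation of the germ of `f` at `p` along a curve
that avoids `P`. -/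
def IsContinuationTo (g : ConformalMetric) (P : Set (OnePoint ℂ)) (p : OnePoint ℂ)
    (f : OnePoint ℂ → ℂ) (q : OnePoint ℂ) (φ : OnePoint ℂ → ℂ) : Prop :=
  IsLocalIsometryAt g φ q ∧ ∃ γ : Path p q, (∀ t, γ t ∉ P) ∧
    ∃ F, IsContinuationAlong g γ F ∧ F 0 =ᶠ[𝓝[≠] p] f ∧ F 1 =ᶠ[𝓝[≠] q] φ

theorem IsDevelopingMap.exists_isContinuationTo (hf : IsDevelopingMap g P p f)
    (h : JoinedIn Pᶜ p q) : ∃ φ, IsContinuationTo g P p f q φ := by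
  obtain ⟨γ, hγ⟩ := h
  obtain ⟨F, hF, hF0⟩ := hf.continuation q γ hγ
  exact ⟨F 1, by simpa using (hF 1).1, γ, hγ, F, hF, hF0, EventuallyEq.rfl⟩

theorem Path.trans_notMem {r : OnePoint ℂ} {γ : Path p q} {γ' : Path q r} (h : ∀ t, γ t ∉ P)
    (h' : ∀ t, γ' t ∉ P) (t : I) : γ.trans γ' t ∉ P := by
  rw [Path.trans_apply]
  split_ifs
  exacts [h _, h' _]

/-- A germ reached by continuation represents germs reached by continuation at all nearby points:
append a short segment to the curve. -/
theorem IsContinuationTo.eventually (hf : IsDevelopingMap g P p f) (hP : IsClosed P) {z : ℂ}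
    (h : IsContinuationTo g P p f z φ) : ∀ᶠ w : ℂ in 𝓝 z, IsContinuationTo g P p f w φ := by
  obtain ⟨hφ, γ, hγ, F, hF, hF0, hF1⟩ := h
  have hz : (z : OnePoint ℂ) ∉ P := by simpa using hγ 1
  have h1 : ∀ᶠ w : ℂ in 𝓝 z, (w : OnePoint ℂ) ∉ P ∧ IsLocalIsometryAt g φ w :=
    ((OnePoint.continuous_coe.continuousAt.eventually (hP.isOpen_compl.mem_nhds hz))).and
      hφ.eventually
  obtain ⟨ε, hε, hb⟩ := Metric.eventually_nhds_iff_ball.1 h1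
  filter_upwards [Metric.ball_mem_nhds z hε] with w hw
  refine ⟨(hb w hw).2, ?_⟩
  have hc : Continuous fun t : ℝ => ((AffineMap.lineMap z w t : ℂ) : OnePoint ℂ) :=
    OnePoint.continuous_coe.comp AffineMap.lineMap_continuous
  let δ : Path (z : OnePoint ℂ) (w : OnePoint ℂ) :=
    { toFun := fun t => ((AffineMap.lineMap z w (t : ℝ) : ℂ) : OnePoint ℂ)
      continuous_toFun := hc.comp continuous_subtype_val
      source' := by simp
      target' := by simp }
  have hδb : ∀ t : I, AffineMap.lineMap z w (t : ℝ) ∈ Metric.ball z ε := fun t =>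
    (convex_ball z ε).lineMap_mem (Metric.mem_ball_self hε) hw t.2
  have hδ : ∀ t, δ t ∉ P := fun t => (hb _ (hδb t)).1
  refine ⟨γ.trans δ, Path.trans_notMem hγ hδ, ?_⟩
  obtain ⟨G, hG, hG0⟩ := hf.continuation w (γ.trans δ) (Path.trans_notMem hγ hδ)
  refine ⟨G, hG, hG0, ?_⟩
  have hleft := IsContinuationAlong.comp hG (γ' := γ) unitInterval.continuous_halve
    (Path.trans_halve γ δ)
  have e1 := hF.unique hleft (hF0.trans (by simpa [unitInterval.halve] using hG0.symm)) 1
  -- the second half of the continuation is the constant germ `φ`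
  have hright := IsContinuationAlong.comp hG (γ' := δ)
    (s := fun t => unitInterval.symm (unitInterval.halve (unitInterval.symm t)))
    (unitInterval.continuous_symm.comp
      (unitInterval.continuous_halve.comp unitInterval.continuous_symm))
    (fun t => by rw [Path.trans_symm_halve, unitInterval.symm_symm])
  have hconst : IsContinuationAlong g δ fun _ => φ := fun t =>
    ⟨(hb _ (hδb t)).2, Eventually.of_forall fun _ => EventuallyEq.rfl⟩
  have hmid : unitInterval.symm (unitInterval.halve 1) = unitInterval.halve 1 := by
    ext
    simp [unitInterval.halve]
    norm_num
  have e2 := hright.unique hconst (by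
    simp only [Function.comp_def, unitInterval.symm_zero, hmid]
    rw [Path.target] at e1
    exact e1.symm.trans hF1) 1
  simpa [unitInterval.halve] using e2

/-- If the monodromy is unimodular, two germs reached at the same point differ by a unimodular factor:
continue along the first curve and back along the second one. -/
theorem IsContinuationTo.exists_const_mul (hf : IsDevelopingMap g P p f)
    (hmon : ∀ γ : Path p p, (∀ t, γ t ∉ P) →
      ∀ F, IsContinuationAlong g γ F → F 0 =ᶠ[𝓝[≠] p] f →
        ∃ c : ℂ, ‖c‖ = 1 ∧ F 1 =ᶠ[𝓝[≠] p] fun z => c * f z)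
    (hφ : IsContinuationTo g P p f q φ) (hψ : IsContinuationTo g P p f q ψ) :
    ∃ c : ℂ, ‖c‖ = 1 ∧ φ =ᶠ[𝓝[≠] q] fun y => c * ψ y := by
  obtain ⟨-, γ, hγ, F, hF, hF0, hF1⟩ := hφ
  obtain ⟨-, γ', hγ', F', hF', hF'0, hF'1⟩ := hψ
  have hγs : ∀ t, γ'.symm t ∉ P := fun t => hγ' _
  obtain ⟨G, hG, hG0⟩ := hf.continuation p (γ.trans γ'.symm) (Path.trans_notMem hγ hγs)
  obtain ⟨c, hc, hcG⟩ := hmon _ (Path.trans_notMem hγ hγs) G hG hG0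
  refine ⟨c, hc, ?_⟩
  have hleft := IsContinuationAlong.comp hG (γ' := γ) unitInterval.continuous_halve
    (Path.trans_halve γ _)
  have e1 := hF.unique hleft (hF0.trans (by simpa [unitInterval.halve] using hG0.symm)) 1
  -- run backwards, the second half continues `c * f` along the second curve
  have hright := IsContinuationAlong.comp hG (γ' := γ')
    (s := fun t => unitInterval.symm (unitInterval.halve t))
    (unitInterval.continuous_symm.comp unitInterval.continuous_halve)
    (fun t => by rw [Path.trans_symm_halve, Path.symm_apply, Function.comp_apply,
      unitInterval.symm_symm])
  have hcF' : IsContinuationAlong g γ' fun t y => c * F' t y := fun t =>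
    ⟨(hF' t).1.const_mul hc, (hF' t).2.mono fun s hs => hs.fun_comp (c * ·)⟩
  have hmid : unitInterval.symm (unitInterval.halve 1) = unitInterval.halve 1 := by
    ext
    simp [unitInterval.halve]
    norm_num
  have h0 : unitInterval.symm (unitInterval.halve 0) = 1 := by
    ext
    simp [unitInterval.halve]
  have e2 := hright.unique hcF' (by
    simp only [Function.comp_def, h0]
    exact hcG.trans (hF'0.symm.fun_comp (c * ·))) 1
  simp only [Function.comp_def, hmid] at e1 e2
  rw [Path.target] at e1 e2
  exact (hF1.symm.trans (e1.trans e2)).trans (hF'1.fun_comp (c * ·))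

theorem continuous_sphereCoord_infty : Continuous (sphereCoord OnePoint.infty) := by
  rw [continuous_iff_continuousAt]
  intro w
  by_cases hw : w = 0
  · subst hw
    have h0 : sphereCoord OnePoint.infty 0 = OnePoint.infty := by simp [sphereCoord]
    rw [continuousAt_iff_punctured_nhds, h0]
    exact (map_sphereCoord_nhdsNE OnePoint.infty).le.trans nhdsWithin_le_nhds
  · have : sphereCoord OnePoint.infty =ᶠ[𝓝 w] fun w => ((w⁻¹ : ℂ) : OnePoint ℂ) := by
      filter_upwards [isOpen_ne.mem_nhds hw] with v hv
      simp only [sphereCoord]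
      exact if_neg hv
    exact (OnePoint.continuous_coe.continuousAt.comp (continuousAt_inv₀ hw)).congr this.symm

theorem joinedIn_compl_of_finite (hP : P.Finite) (hp : p ∉ P) {z : ℂ} (hz : (z : OnePoint ℂ) ∉ P) :
    JoinedIn Pᶜ p z := by
  have hfin : ∀ {u v : ℂ}, (u : OnePoint ℂ) ∉ P → (v : OnePoint ℂ) ∉ P →
      JoinedIn Pᶜ (u : OnePoint ℂ) v := by
    intro u v hu hv
    have hc : ((fun w : ℂ => (w : OnePoint ℂ)) ⁻¹' P).Countable :=
      (hP.preimage OnePoint.coe_injective.injOn).countable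
    have := (hc.isPathConnected_compl_of_one_lt_rank (by simp)).joinedIn u hu v hv
    exact (this.map OnePoint.continuous_coe).mono (by rintro _ ⟨w, hw, rfl⟩; exact hw)
  induction p using OnePoint.rec with
  | coe u => exact hfin hp hz
  | infty =>
    have h0 : sphereCoord OnePoint.infty 0 = OnePoint.infty := by simp [sphereCoord]
    have h1 : ∀ᶠ w in 𝓝 (0 : ℂ), sphereCoord OnePoint.infty w ∉ P :=
      continuous_sphereCoord_infty.continuousAt.eventually
        (hP.isClosed.isOpen_compl.mem_nhds (by rwa [h0]))
    obtain ⟨ε, hε, hb⟩ := Metric.eventually_nhds_iff_ball.1 h1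
    have hd : (((ε / 2 : ℝ) : ℂ)) ≠ 0 := by
      norm_cast
      positivity
    have hm : ((ε / 2 : ℝ) : ℂ) ∈ Metric.ball (0 : ℂ) ε := by
      rw [mem_ball_zero_iff, Complex.norm_real, Real.norm_of_nonneg (by positivity)]
      linarith
    have hcoe : sphereCoord OnePoint.infty ((ε / 2 : ℝ) : ℂ)
        = (((((ε / 2 : ℝ) : ℂ))⁻¹ : ℂ) : OnePoint ℂ) := by
      simp only [sphereCoord]
      exact if_neg hd
    have hj : JoinedIn (Metric.ball (0 : ℂ) ε) 0 ((ε / 2 : ℝ) : ℂ) :=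
      ((convex_ball (0 : ℂ) ε).isPathConnected ⟨0, Metric.mem_ball_self hε⟩).joinedIn _
        (Metric.mem_ball_self hε) _ hm
    have hj' := (hj.map continuous_sphereCoord_infty).mono (V := Pᶜ)
      (by rintro _ ⟨w, hw, rfl⟩; exact hb w hw)
    rw [h0, hcoe] at hj'
    exact hj'.trans (hfin (hcoe ▸ hb _ hm) hz)

/-- A co-axial metric carries a rotation field on the whole finite part of the complement of the
singularities: `φ / φ'` and `|φ|` do not change when `φ` is multiplied by a unimodular constant. -/
theorem IsCoaxial.exists_isRotationFieldAt (hP : P.Finite) (hco : IsCoaxial g P)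
    (hpos : ∀ z : ℂ, (z : OnePoint ℂ) ∉ P → 0 < g.dens z)
    (hcont : ∀ z : ℂ, (z : OnePoint ℂ) ∉ P → ContinuousAt g.dens z) :
    ∃ (k : ℂ → ℂ) (x : ℂ → ℝ), ∀ z : ℂ, (z : OnePoint ℂ) ∉ P → IsRotationFieldAt g.dens k x z := by
  obtain ⟨p, f, hf, hmon⟩ := hco
  have hex : ∀ z : ℂ, ∃ φ, (z : OnePoint ℂ) ∉ P → IsContinuationTo g P p f z φ := fun z => by
    by_cases hz : (z : OnePoint ℂ) ∈ P
    · exact ⟨f, fun h => absurd hz h⟩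
    · obtain ⟨φ, hφ⟩ := hf.exists_isContinuationTo (joinedIn_compl_of_finite hP hf.base hz)
      exact ⟨φ, fun _ => hφ⟩
  choose φ hφ using hex
  refine ⟨fun z => limUnder (𝓝[≠] z) fun w : ℂ => φ z w / deriv (fun u : ℂ => φ z u) w,
    fun z => limUnder (𝓝[≠] z) fun w : ℂ => (1 - ‖φ z w‖ ^ 2) / (1 + ‖φ z w‖ ^ 2), fun z hz => ?_⟩
  have hiso := isLocalIsometryAt_coe.1 (hφ z hz).1
  obtain ⟨k, x, hk, hx, hkx⟩ :=
    hiso.1.exists_isRotationFieldAt (hcont z hz) (hpos z hz) hiso.2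
  have hnear : ∀ᶠ w : ℂ in 𝓝 z, (w : OnePoint ℂ) ∉ P :=
    OnePoint.continuous_coe.continuousAt.eventually (hP.isClosed.isOpen_compl.mem_nhds hz)
  -- the continuations at nearby points differ from `φ z` by a unimodular factor
  have hmul : ∀ᶠ w : ℂ in 𝓝 z, ∃ c : ℂ, ‖c‖ = 1 ∧
      ∀ᶠ u : ℂ in 𝓝[≠] w, φ w u = c * φ z u := by
    filter_upwards [hnear, (hφ z hz).eventually hf hP.isClosed] with w h1 h2
    obtain ⟨c, hc, h⟩ := (hφ w h1).exists_const_mul hf hmon h2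
    refine ⟨c, hc, ?_⟩
    rwa [EventuallyEq, OnePoint.nhdsNE_coe, eventually_map] at h
  refine hkx.self_of_nhds.congr rfl ?_ ?_
  · filter_upwards [hmul, eventually_eventually_nhdsNE hk, hkx] with w h1 h2 h3
    obtain ⟨c, hc, hcw⟩ := h1
    refine (Tendsto.limUnder_eq ((h3.analyticAt.continuousAt.tendsto.mono_left
      nhdsWithin_le_nhds).congr' ?_)).symm
    have hd : deriv (fun u : ℂ => φ w u) =ᶠ[𝓝[≠] w] deriv fun u : ℂ => c * φ z u :=
      EventuallyEq.nhdsNE_deriv hcw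
    have hc0 : c ≠ 0 := norm_ne_zero_iff.1 (by rw [hc]; exact one_ne_zero)
    filter_upwards [h2, hcw, hd] with u a b d
    rw [d, b, deriv_const_mul_field, mul_div_mul_left _ _ hc0, a]
  · filter_upwards [hmul, eventually_eventually_nhdsNE hx, hkx] with w h1 h2 h3
    obtain ⟨c, hc, hcw⟩ := h1
    refine (Tendsto.limUnder_eq ((h3.hasFDerivAt.continuousAt.tendsto.mono_left
      nhdsWithin_le_nhds).congr' ?_)).symm
    filter_upwards [h2, hcw] with u a b
    rw [b, norm_mul, hc, one_mul, a]

end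

/-! ### Limits and derivatives near a puncture -/

/-- A function on a punctured disc whose gradient is `O(|z| ^ (α - 1))` with `α > 0` has a limit at the
puncture, since the metric `|z| ^ (α - 1) |dz|` makes the puncture a point at finite distance around
which the circles have lengths tending to zero. -/
theorem exists_tendsto_of_norm_fderiv_le {x : ℂ → ℝ} {x' : ℂ → ℂ →L[ℝ] ℝ} {C α B : ℝ} (hα : 0 < α)
    (hC : 0 ≤ C)
    (h : ∀ᶠ z in 𝓝[≠] 0, HasFDerivAt x (x' z) z ∧ ‖x' z‖ ≤ C * ‖z‖ ^ (α - 1) ∧ B ≤ x z) :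
    ∃ x₀, Tendsto x (𝓝[≠] 0) (𝓝 x₀) := by
  obtain ⟨δ, hδ, hb⟩ := Metric.eventually_nhds_iff_ball.1 (eventually_nhdsWithin_iff.1 h)
  have hball : ∀ z : ℂ, 0 < ‖z‖ → ‖z‖ < δ →
      HasFDerivAt x (x' z) z ∧ ‖x' z‖ ≤ C * ‖z‖ ^ (α - 1) ∧ B ≤ x z :=
    fun z h1 h2 => hb z (by simpa using h2) (norm_pos_iff.1 h1)
  have hnorm : ∀ t : ℝ, 0 < t → ‖(t : ℂ)‖ = t := fun t ht => by
    rw [Complex.norm_real, Real.norm_of_nonneg ht.le]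
  have hpow : Tendsto (fun t : ℝ => t ^ α) (𝓝[>] 0) (𝓝 0) := by
    have := (Real.continuousAt_rpow_const 0 α (Or.inr hα.le)).tendsto
    rw [Real.zero_rpow hα.ne'] at this
    exact this.mono_left nhdsWithin_le_nhds
  -- along the positive axis, `x` becomes monotone after adding `C / α * t ^ α`
  have hder : ∀ t ∈ Ioo 0 δ, HasDerivAt (fun t : ℝ => x t + C / α * t ^ α)
      (x' t 1 + C * t ^ (α - 1)) t := by
    intro t ht
    have h1 := (hball t (by rw [hnorm t ht.1]; exact ht.1) (by rw [hnorm t ht.1]; exact ht.2)).1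
    have h2 := h1.comp_hasDerivAt t (Complex.ofRealCLM.hasDerivAt (x := t))
    have h3 := (Real.hasDerivAt_rpow_const (x := t) (p := α) (Or.inl ht.1.ne')).const_mul (C / α)
    refine (h2.add h3).congr_deriv ?_
    simp
    field_simp
  have hmono : MonotoneOn (fun t : ℝ => x t + C / α * t ^ α) (Ioo 0 δ) := by
    refine monotoneOn_of_deriv_nonneg (convex_Ioo 0 δ)
      (fun t ht => (hder t ht).continuousAt.continuousWithinAt)
      (fun t ht => (hder t (interior_subset ht)).differentiableAt.differentiableWithinAt)
      fun t ht => ?_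
    have ht' := interior_subset ht
    rw [(hder t ht').deriv]
    have h1 := (hball t (by rw [hnorm t ht'.1]; exact ht'.1) (by rw [hnorm t ht'.1]; exact ht'.2))
    have h2 := (x' t).le_opNorm 1
    rw [hnorm t ht'.1] at h1
    rw [norm_one, mul_one] at h2
    linarith [neg_abs_le (x' t 1), Real.norm_eq_abs (x' t 1), h1.2.1]
  have hbdd : BddBelow ((fun t : ℝ => x t + C / α * t ^ α) '' Ioo 0 δ) := by
    refine ⟨B, ?_⟩
    rintro _ ⟨t, ht, rfl⟩
    have h1 := (hball t (by rw [hnorm t ht.1]; exact ht.1) (by rw [hnorm t ht.1]; exact ht.2)).2.2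
    have : 0 ≤ C / α * t ^ α := by
      have := ht.1.le
      positivity
    simp only
    linarith
  obtain ⟨L, hL⟩ : ∃ L, Tendsto (fun t : ℝ => x t + C / α * t ^ α) (𝓝[>] 0) (𝓝 L) := by
    have := hmono.tendsto_nhdsWithin_Ioo_right (nonempty_Ioo.2 hδ) hbdd
    exact ⟨_, this⟩
  have hray : Tendsto (fun t : ℝ => x t) (𝓝[>] 0) (𝓝 L) := by
    have := hL.sub (hpow.const_mul (C / α))
    simpa using this
  -- on circles, `x` oscillates by at most `π * C * r ^ α`
  have hcirc : ∀ᶠ z : ℂ in 𝓝[≠] 0, ‖x z - x (‖z‖ : ℂ)‖ ≤ Real.pi * C * ‖z‖ ^ α := by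
    have hev : ∀ᶠ z : ℂ in 𝓝[≠] 0, ‖z‖ < δ := by
      filter_upwards [nhdsWithin_le_nhds (Metric.ball_mem_nhds 0 hδ)] with z hz
      simpa using hz
    filter_upwards [hev, self_mem_nhdsWithin] with z hz hz0
    have hz1 : 0 < ‖z‖ := norm_pos_iff.2 hz0
    have hn : ∀ s : ℝ, ‖(‖z‖ : ℂ) * Complex.exp (s * Complex.I)‖ = ‖z‖ := fun s => by
      rw [norm_mul, Complex.norm_exp_ofReal_mul_I, mul_one, hnorm _ hz1]
    have hd : ∀ s : ℝ, HasDerivAt (fun s : ℝ => (‖z‖ : ℂ) * Complex.exp (s * Complex.I))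
        ((‖z‖ : ℂ) * (Complex.exp (s * Complex.I) * Complex.I)) s := fun s => by
      have h1 : HasDerivAt (fun s : ℝ => (s : ℂ) * Complex.I) Complex.I s := by
        simpa using (Complex.ofRealCLM.hasDerivAt (x := s)).mul_const Complex.I
      exact h1.cexp.const_mul _
    have hb := fun s : ℝ => hball ((‖z‖ : ℂ) * Complex.exp (s * Complex.I)) (by rw [hn]; exact hz1)
      (by rw [hn]; exact hz)
    have := Convex.norm_image_sub_le_of_norm_hasDerivWithin_le (s := univ)
      (C := C * ‖z‖ ^ α) (x := 0) (y := z.arg)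
      (fun s _ => ((hb s).1.comp_hasDerivAt s (hd s)).hasDerivWithinAt)
      (fun s _ => ?_) convex_univ (mem_univ _) (mem_univ _)
    · simp only [Function.comp_apply, Complex.norm_mul_exp_arg_mul_I, Complex.ofReal_zero, zero_mul,
        Complex.exp_zero, mul_one, sub_zero] at this
      refine this.trans ?_
      rw [Real.norm_eq_abs]
      have h1 := Complex.abs_arg_le_pi z
      have h2 : 0 ≤ C * ‖z‖ ^ α := by positivity
      nlinarith
    · refine ((x' _).le_opNorm _).trans ?_
      have h1 := (hb s).2.1
      rw [hn] at h1
      have h2 : ‖(‖z‖ : ℂ) * (Complex.exp (s * Complex.I) * Complex.I)‖ = ‖z‖ := by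
        rw [← mul_assoc, norm_mul, hn, Complex.norm_I, mul_one]
      rw [h2]
      calc _ ≤ C * ‖z‖ ^ (α - 1) * ‖z‖ := by gcongr
        _ = C * ‖z‖ ^ α := by
          rw [mul_assoc, ← Real.rpow_add_one hz1.ne', sub_add_cancel]
  refine ⟨L, ?_⟩
  have h1 : Tendsto (fun z : ℂ => x (‖z‖ : ℂ)) (𝓝[≠] 0) (𝓝 L) :=
    hray.comp tendsto_norm_nhdsNE_zero
  have h2 : Tendsto (fun z : ℂ => x z - x (‖z‖ : ℂ)) (𝓝[≠] 0) (𝓝 0) := by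
    refine squeeze_zero_norm' hcirc ?_
    simpa using (hpow.comp tendsto_norm_nhdsNE_zero).const_mul (Real.pi * C)
  simpa using h1.add h2

/-- If `Y` has a limit at `0`, then `r * Y' r` is small for some arbitrarily small `r`. This is the mean
value theorem on `[r, 2 r]`. -/
theorem frequently_abs_mul_deriv_lt {Y Y' : ℝ → ℝ} {L ε : ℝ} (hY : Tendsto Y (𝓝[>] 0) (𝓝 L))
    (hd : ∀ᶠ r in 𝓝[>] 0, HasDerivAt Y (Y' r) r) (hε : 0 < ε) :
    ∃ᶠ r in 𝓝[>] 0, |r * Y' r| < ε := by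
  intro hnot
  obtain ⟨δ, hδ, hb⟩ := mem_nhdsGT_iff_exists_Ioo_subset.1 (hd.and hnot)
  have h2 : Tendsto (fun r : ℝ => 2 * r) (𝓝[>] 0) (𝓝[>] 0) := by
    refine tendsto_nhdsWithin_iff.2 ⟨?_, ?_⟩
    · have : Tendsto (fun r : ℝ => 2 * r) (𝓝 0) (𝓝 (2 * 0)) := tendsto_id.const_mul 2
      rw [mul_zero] at this
      exact this.mono_left nhdsWithin_le_nhds
    · filter_upwards [self_mem_nhdsWithin] with r hr
      simpa using hr
  have h3 := ((hY.comp h2).sub hY).abs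
  rw [sub_self, abs_zero] at h3
  have h4 : ∀ᶠ r in 𝓝[>] (0 : ℝ), 2 * r ∈ Ioo 0 δ := h2.eventually (Ioo_mem_nhdsGT hδ)
  obtain ⟨r, hr1, hr2, hr3⟩ :=
    ((h3.eventually (gt_mem_nhds (half_pos hε))).and (h4.and self_mem_nhdsWithin)).exists
  have hr0 : 0 < r := hr3
  have hsub : ∀ s ∈ Icc r (2 * r), s ∈ Ioo 0 δ := fun s hs =>
    ⟨hr0.trans_le hs.1, hs.2.trans_lt hr2.2⟩
  obtain ⟨s, hs, hs'⟩ := exists_hasDerivAt_eq_slope Y Y' (show r < 2 * r by linarith)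
    (fun s hs => (hb (hsub s hs)).1.continuousAt.continuousWithinAt)
    (fun s hs => (hb (hsub s (Ioo_subset_Icc_self hs))).1)
  refine (hb (hsub s (Ioo_subset_Icc_self hs))).2 ?_
  simp only [Function.comp_apply] at hr1
  have hY' : Y' s * r = Y (2 * r) - Y r := by
    rw [hs']
    field_simp
    ring
  rw [← hY', abs_mul, abs_of_pos hr0] at hr1
  simp only [abs_mul, abs_of_pos (hr0.trans hs.1)]
  nlinarith [hs.2, abs_nonneg (Y' s)]

/-! ### Rotation fields at cone points -/

section

variable {ρ x : ℂ → ℝ} {k : ℂ → ℂ} {α β c : ℝ}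

theorem tendsto_rpow_norm_nhdsNE_zero (hα : 0 < α) :
    Tendsto (fun z : ℂ => ‖z‖ ^ α) (𝓝[≠] 0) (𝓝 0) := by
  have := (Real.continuousAt_rpow_const 0 α (Or.inr hα.le)).tendsto
  rw [Real.zero_rpow hα.ne'] at this
  exact this.comp tendsto_norm_zero |>.mono_left nhdsWithin_le_nhds

/-- A rotation field is meromorphic at a cone point, because its component is bounded by `1 / ρ`. -/
theorem IsRotationFieldAt.meromorphicAt_zero (hrot : ∀ᶠ w in 𝓝[≠] 0, IsRotationFieldAt ρ k x w)
    (hc : 0 < c) (hρ : Tendsto (fun w => ρ w / ‖w‖ ^ (α - 1)) (𝓝[≠] 0) (𝓝 c)) :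
    MeromorphicAt k 0 := by
  obtain ⟨n, hn⟩ := exists_nat_gt (max α 0)
  have hn0 : n ≠ 0 := by
    rintro rfl
    simp at hn
  refine ⟨n, Complex.analyticAt_of_differentiable_on_punctured_nhds_of_continuousAt ?_ ?_⟩
  · filter_upwards [hrot] with w hw
    exact ((differentiableAt_id.sub_const 0).pow n).smul hw.analyticAt.differentiableAt
  · rw [continuousAt_iff_punctured_nhds]
    simp only [sub_zero, ne_eq, hn0, not_false_eq_true, zero_pow, zero_smul]
    have hlim : Tendsto (fun w : ℂ => ‖w‖ ^ (n + 1 - α) * (ρ w / ‖w‖ ^ (α - 1))⁻¹) (𝓝[≠] 0)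
        (𝓝 (0 * c⁻¹)) :=
      (tendsto_rpow_norm_nhdsNE_zero (by linarith [le_max_left α 0])).mul (hρ.inv₀ hc.ne')
    rw [zero_mul] at hlim
    refine squeeze_zero_norm' ?_ hlim
    filter_upwards [hrot, self_mem_nhdsWithin] with w hw hw0
    have h0 : 0 < ‖w‖ := norm_pos_iff.2 hw0
    have h1 : ‖k w‖ ≤ (ρ w)⁻¹ := by
      rw [← one_div, le_div_iff₀' hw.pos]
      exact hw.mul_norm_le_one
    rw [norm_smul, norm_pow, inv_div, mul_div_assoc', ← Real.rpow_add h0]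
    have : (n + 1 - α + (α - 1)) = (n : ℝ) := by ring
    rw [this, Real.rpow_natCast, div_eq_mul_inv]
    gcongr

theorem tendsto_ofReal_mul_nhdsNE {e : ℂ} (he : e ≠ 0) :
    Tendsto (fun r : ℝ => (r : ℂ) * e) (𝓝[>] 0) (𝓝[≠] 0) := by
  refine tendsto_nhdsWithin_iff.2 ⟨?_, ?_⟩
  · have : Tendsto (fun r : ℝ => (r : ℂ) * e) (𝓝 0) (𝓝 (((0 : ℝ) : ℂ) * e)) :=
      ((Complex.continuous_ofReal.tendsto 0).mul_const e)
    rw [Complex.ofReal_zero, zero_mul] at this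
    exact this.mono_left nhdsWithin_le_nhds
  · filter_upwards [self_mem_nhdsWithin] with r hr
    exact mul_ne_zero (by exact_mod_cast (ne_of_gt hr)) he

/-- If the length of the field is comparable to `|w| ^ β`, then on each ray the logarithm of
`1 - x² = (ρ |k|)²` minus `2 β log r` converges. Its derivative with respect to `log r` is
`2 (x Re (w / k) - β)`, which is therefore small at points arbitrarily close to `0`. -/
theorem IsRotationFieldAt.frequently_ray (hrot : ∀ᶠ w in 𝓝[≠] 0, IsRotationFieldAt ρ k x w)
    (hk : ∀ᶠ w in 𝓝[≠] 0, k w ≠ 0) {A : ℝ} (hA : 0 < A)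
    (hlim : Tendsto (fun w => ρ w * ‖k w‖ / ‖w‖ ^ β) (𝓝[≠] 0) (𝓝 A)) {e : ℂ} (he : ‖e‖ = 1)
    {ε : ℝ} (hε : 0 < ε) :
    ∃ᶠ r : ℝ in 𝓝[>] 0, |x (r * e) * (r * e / k (r * e)).re - β| < ε := by
  have he0 : e ≠ 0 := norm_ne_zero_iff.1 (by rw [he]; exact one_ne_zero)
  have hray := tendsto_ofReal_mul_nhdsNE he0
  have hn : ∀ r : ℝ, 0 < r → ‖(r : ℂ) * e‖ = r := fun r hr => by
    rw [norm_mul, he, mul_one, Complex.norm_real, Real.norm_of_nonneg hr.le]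
  have hY : Tendsto (fun r : ℝ => Real.log (1 - x (r * e) ^ 2) - 2 * β * Real.log r) (𝓝[>] 0)
      (𝓝 (Real.log (A ^ 2))) := by
    refine (((hlim.pow 2).log (by positivity)).comp hray).congr' ?_
    filter_upwards [hray.eventually hrot, hray.eventually hk, self_mem_nhdsWithin] with r h1 h2 h3
    have h3' : 0 < r := h3
    have h4 : 1 - x (r * e) ^ 2 = (ρ (r * e) * ‖k (r * e)‖) ^ 2 := by linarith [h1.sq_add_sq]
    have h5 := h1.pos
    have h6 := norm_pos_iff.2 h2
    simp only [Function.comp_apply]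
    rw [h4, hn r h3', div_pow, Real.log_div (by positivity) (by positivity), Real.log_pow (r ^ β),
      Real.log_rpow h3']
    push_cast
    ring
  have hd : ∀ᶠ r : ℝ in 𝓝[>] 0,
      HasDerivAt (fun r : ℝ => Real.log (1 - x (r * e) ^ 2) - 2 * β * Real.log r)
        (2 * (x (r * e) * (r * e / k (r * e)).re - β) / r) r := by
    filter_upwards [hray.eventually hrot, hray.eventually hk, self_mem_nhdsWithin] with r h1 h2 h3
    have h3' : 0 < r := h3
    have h4 : 1 - x (r * e) ^ 2 = (ρ (r * e) * ‖k (r * e)‖) ^ 2 := by linarith [h1.sq_add_sq]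
    have h5 := h1.pos
    have h6 := norm_pos_iff.2 h2
    have hγ : HasDerivAt (fun r : ℝ => (r : ℂ) * e) e r := by
      simpa using (Complex.ofRealCLM.hasDerivAt (x := r)).mul_const e
    have h7 := h1.hasDerivAt_comp hγ rfl
    have h8 : 1 - x (r * e) ^ 2 ≠ 0 := by
      rw [h4]
      positivity
    refine ((((h7.pow 2).const_sub 1).log h8).sub
      ((Real.hasDerivAt_log h3'.ne').const_mul (2 * β))).congr_deriv ?_
    have h9 : ((r : ℂ) * e / k (r * e)).re
        = r * ((starRingEnd ℂ) (k (r * e)) * e).re / ‖k (r * e)‖ ^ 2 := by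
      rw [mul_div_assoc, Complex.re_ofReal_mul, Complex.div_re, Complex.sq_norm]
      simp
      ring
    rw [h9]
    simp only [Pi.pow_apply]
    rw [h4]
    field_simp
    push_cast
    ring
  refine ((frequently_abs_mul_deriv_lt hY hd (ε := 2 * ε) (by positivity)).and_eventually
    self_mem_nhdsWithin).mono ?_
  rintro r ⟨h1, h2⟩
  have h2' : r ≠ 0 := ne_of_gt h2
  rw [mul_div_cancel₀ _ h2', abs_mul, abs_two] at h1
  linarith

/-- On each small circle, the restriction of `x` has a critical point by Rolle's theorem, and there
`w / k w` is real. -/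
theorem IsRotationFieldAt.frequently_im_eq_zero
    (hrot : ∀ᶠ w in 𝓝[≠] 0, IsRotationFieldAt ρ k x w) :
    ∃ᶠ w in 𝓝[≠] 0, (w / k w).im = 0 := by
  intro hnot
  obtain ⟨δ, hδ, hb⟩ :=
    Metric.eventually_nhds_iff_ball.1 (eventually_nhdsWithin_iff.1 (hrot.and hnot))
  have hr : 0 < δ / 2 := half_pos hδ
  have hn : ∀ s : ℝ, ‖((δ / 2 : ℝ) : ℂ) * Complex.exp (s * Complex.I)‖ = δ / 2 := fun s => by
    rw [norm_mul, Complex.norm_exp_ofReal_mul_I, mul_one, Complex.norm_real,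
      Real.norm_of_nonneg hr.le]
  have hd : ∀ s : ℝ, HasDerivAt (fun s : ℝ => ((δ / 2 : ℝ) : ℂ) * Complex.exp (s * Complex.I))
      (((δ / 2 : ℝ) : ℂ) * (Complex.exp (s * Complex.I) * Complex.I)) s := fun s => by
    have h1 : HasDerivAt (fun s : ℝ => (s : ℂ) * Complex.I) Complex.I s := by
      simpa using (Complex.ofRealCLM.hasDerivAt (x := s)).mul_const Complex.I
    exact h1.cexp.const_mul _
  have hmem := fun s : ℝ => hb (((δ / 2 : ℝ) : ℂ) * Complex.exp (s * Complex.I))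
    (by rw [mem_ball_zero_iff, hn]; linarith)
    (by
      rw [mem_compl_singleton_iff, ← norm_ne_zero_iff, hn]
      exact hr.ne')
  have hx := fun s : ℝ => (hmem s).1.hasDerivAt_comp (hd s) rfl
  obtain ⟨s, -, hs⟩ := exists_hasDerivAt_eq_zero (a := 0) (b := 2 * Real.pi) (by positivity)
    (fun s _ => (hx s).continuousAt.continuousWithinAt) (by simp) (fun s _ => hx s)
  refine (hmem s).2 ?_
  have hpos := (hmem s).1.pos
  have h0 := (mul_eq_zero.1 hs).resolve_left (by
    have := pow_pos hpos 2
    linarith)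
  rw [← mul_assoc, ← mul_assoc, mul_comm, Complex.I_mul_re, neg_eq_zero] at h0
  simp only [div_eq_mul_inv _ (k _), Complex.inv_def, ← mul_assoc, Complex.im_mul_ofReal]
  rw [mul_comm _ (starRingEnd ℂ _), ← mul_assoc, h0, zero_mul]

/-- The behaviour of a rotation field at a cone point of angle `2 π α`: either the field has a simple
zero there and the residue of its dual form `dw / k` is `±α`, or its order is `1 - α`, so that `α` is
an integer. The first case occurs when the developing map tends to `0` or `∞`, the second one when it
has another limit. -/
theorem IsRotationFieldAt.exists_order (hα : 0 < α) (hc : 0 < c)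
    (hρ : Tendsto (fun w => ρ w / ‖w‖ ^ (α - 1)) (𝓝[≠] 0) (𝓝 c))
    (hrot : ∀ᶠ w in 𝓝[≠] 0, IsRotationFieldAt ρ k x w) :
    ∃ (m : ℤ) (r : ℝ), MeromorphicAt k 0 ∧ meromorphicOrderAt k 0 = m ∧
      Tendsto (fun w => w / k w) (𝓝[≠] 0) (𝓝 (r : ℂ)) ∧
      ((m = 1 ∧ (r = α ∨ r = -α)) ∨ ((m : ℝ) = 1 - α ∧ r = 0)) := by
  have hmer := IsRotationFieldAt.meromorphicAt_zero hrot hc hρ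
  have hk : ∀ᶠ w in 𝓝[≠] 0, k w ≠ 0 := by
    refine hmer.eventually_eq_zero_or_eventually_ne_zero.resolve_left fun h0 => ?_
    have h0' := (eventually_eventually_nhdsNE h0).filter_mono (nhdsWithin_le_nhds (s := {0}ᶜ))
    obtain ⟨w, h1, h2⟩ := (h0'.and hrot).exists
    obtain ⟨v, h3, h4⟩ := (h1.and h2.eventually_ne).exists
    exact h4 h3
  have htop := (meromorphicOrderAt_ne_top_iff_eventually_ne_zero hmer).2 hk
  obtain ⟨g, hg, hg0, hkg⟩ := (meromorphicOrderAt_ne_top_iff hmer).1 htop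
  simp only [sub_zero, smul_eq_mul] at hkg
  set m := (meromorphicOrderAt k 0).untop₀
  have hord : meromorphicOrderAt k 0 = m := (WithTop.coe_untop₀_of_ne_top htop).symm
  have hglim : Tendsto g (𝓝[≠] 0) (𝓝 (g 0)) := hg.continuousAt.tendsto.mono_left nhdsWithin_le_nhds
  have hquot : ∀ᶠ w in 𝓝[≠] 0, w / k w = w ^ (1 - m) * (g w)⁻¹ := by
    filter_upwards [hkg, self_mem_nhdsWithin] with w h1 h2
    rw [h1, zpow_sub₀ h2, zpow_one]
    field_simp
  have hginv : Tendsto (fun w => (g w)⁻¹) (𝓝[≠] 0) (𝓝 (g 0)⁻¹) := hglim.inv₀ hg0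
  -- the length of the field is comparable to the power `β` of the distance
  obtain ⟨β, hβ⟩ : ∃ β : ℝ, β = m + (α - 1) := ⟨_, rfl⟩
  have hA : 0 < c * ‖g 0‖ := mul_pos hc (norm_pos_iff.2 hg0)
  have hlen : Tendsto (fun w => ρ w * ‖k w‖ / ‖w‖ ^ β) (𝓝[≠] 0) (𝓝 (c * ‖g 0‖)) := by
    refine (hρ.mul hglim.norm).congr' ?_
    filter_upwards [hkg, self_mem_nhdsWithin] with w h1 h2
    have h3 : 0 < ‖w‖ := norm_pos_iff.2 h2
    rw [h1, norm_mul, norm_zpow, hβ, Real.rpow_add h3, Real.rpow_intCast]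
    have := zpow_pos h3 m
    have := Real.rpow_pos_of_pos h3 (α - 1)
    field_simp
  have hmlt : m < 1 → Tendsto (fun w => w / k w) (𝓝[≠] 0) (𝓝 0) := fun h => by
    refine Tendsto.congr' (hquot.mono fun w hw => hw.symm) ?_
    obtain ⟨n, hn⟩ := Int.eq_ofNat_of_zero_le (show 0 ≤ 1 - m by omega)
    have hn0 : n ≠ 0 := by omega
    have h1 : Tendsto (fun w : ℂ => w ^ (1 - m)) (𝓝[≠] 0) (𝓝 0) := by
      rw [hn]
      simp only [zpow_natCast]
      have := ((continuous_pow n).tendsto (0 : ℂ)).mono_left (nhdsWithin_le_nhds (s := {0}ᶜ))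
      rwa [zero_pow hn0] at this
    simpa using h1.mul hginv
  -- `β < 0` is excluded since the length is at most `1`
  rcases lt_trichotomy β 0 with hβ0 | hβ0 | hβ0
  · exfalso
    have h1 : Tendsto (fun w : ℂ => ρ w * ‖k w‖ / ‖w‖ ^ β) (𝓝[≠] 0) (𝓝 0) := by
      refine squeeze_zero_norm' ?_ (tendsto_rpow_norm_nhdsNE_zero (neg_pos.2 hβ0))
      filter_upwards [hrot, self_mem_nhdsWithin] with w hw hw0
      have h3 : 0 < ‖w‖ := norm_pos_iff.2 hw0
      have h4 := Real.rpow_pos_of_pos h3 β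
      have h5 := hw.pos
      rw [Real.norm_of_nonneg (by positivity), Real.rpow_neg h3.le, ← one_div]
      gcongr
      exact hw.mul_norm_le_one
    exact hA.ne' (tendsto_nhds_unique hlen h1)
  · have h1 : (m : ℝ) = 1 - α := by linarith
    refine ⟨m, 0, hmer, hord, ?_, Or.inr ⟨h1, rfl⟩⟩
    have h2 : m < 1 := by
      have : (m : ℝ) < 1 := by linarith
      exact_mod_cast this
    simpa using hmlt h2
  -- the field is small near `0`, so that `x` tends to `1` or to `-1`
  have hlen0 : Tendsto (fun w => ρ w * ‖k w‖) (𝓝[≠] 0) (𝓝 0) := by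
    have := hlen.mul (tendsto_rpow_norm_nhdsNE_zero hβ0)
    rw [mul_zero] at this
    refine this.congr' ?_
    filter_upwards [self_mem_nhdsWithin] with w hw
    have h3 : 0 < ‖w‖ := norm_pos_iff.2 hw
    have h4 := Real.rpow_pos_of_pos h3 β
    field_simp
  obtain ⟨x₀, hx₀⟩ : ∃ x₀, Tendsto x (𝓝[≠] 0) (𝓝 x₀) := by
    refine exists_tendsto_of_norm_fderiv_le (x' := fun w => -(ρ w ^ 2) • innerSL ℝ (k w))
      (C := 2 * c) (B := -1) hα (by positivity) ?_
    filter_upwards [hrot, hρ.eventually (gt_mem_nhds (show c < 2 * c by linarith)),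
      self_mem_nhdsWithin] with w h1 h2 h3
    refine ⟨h1.hasFDerivAt, ?_, (abs_le.1 h1.abs_le_one).1⟩
    have h4 : 0 < ‖w‖ ^ (α - 1) := Real.rpow_pos_of_pos (norm_pos_iff.2 h3) _
    rw [norm_smul, innerSL_apply_norm, norm_neg, Real.norm_of_nonneg (sq_nonneg _)]
    have h5 := h1.mul_norm_le_one
    have h6 := h1.pos
    rw [div_lt_iff₀ h4] at h2
    nlinarith
  have hx₀sq : x₀ ^ 2 = 1 := by
    have h1 : Tendsto (fun w => (ρ w * ‖k w‖) ^ 2 + x w ^ 2) (𝓝[≠] 0) (𝓝 (0 ^ 2 + x₀ ^ 2)) :=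
      (hlen0.pow 2).add (hx₀.pow 2)
    have h2 := tendsto_nhds_unique h1
      (tendsto_const_nhds.congr' (hrot.mono fun w hw => hw.sq_add_sq.symm))
    linarith
  have hx₀or : x₀ = 1 ∨ x₀ = -1 := mul_self_eq_one_iff.1 (by rw [← sq, hx₀sq])
  have hx₀abs : |x₀| = 1 := by rcases hx₀or with h | h <;> simp [h]
  -- a finite limit of `w / k w` is determined by its behaviour on one ray
  have hone : ∀ κ : ℂ, Tendsto (fun w => w / k w) (𝓝[≠] 0) (𝓝 κ) → x₀ * κ.re = β := by
    intro κ hκ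
    by_contra hne
    have hray := tendsto_ofReal_mul_nhdsNE (one_ne_zero (α := ℂ))
    have h1 : Tendsto (fun w => x w * (w / k w).re - β) (𝓝[≠] 0) (𝓝 (x₀ * κ.re - β)) :=
      (hx₀.mul ((Complex.continuous_re.tendsto κ).comp hκ)).sub_const β
    have h2 := (h1.comp hray).abs
    have h3 : 0 < |x₀ * κ.re - β| := abs_pos.2 (sub_ne_zero.2 hne)
    obtain ⟨r, h4, h5⟩ := ((IsRotationFieldAt.frequently_ray hrot hk hA hlen norm_one
      (half_pos h3)).and_eventually (h2.eventually (lt_mem_nhds (half_lt_self h3)))).exists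
    exact lt_asymm h4 h5
  rcases lt_trichotomy m 1 with h | h | h
  · have := hone 0 (hmlt h)
    simp at this
    exact absurd this.symm hβ0.ne'
  · have hκ : Tendsto (fun w => w / k w) (𝓝[≠] 0) (𝓝 (g 0)⁻¹) := by
      refine hginv.congr' ?_
      filter_upwards [hquot] with w hw
      rw [hw, h]
      simp
    have hre := hone _ hκ
    have him : ((g 0)⁻¹).im = 0 := by
      by_contra hne
      obtain ⟨w, h1, h2⟩ := ((IsRotationFieldAt.frequently_im_eq_zero hrot).and_eventually
        (((Complex.continuous_im.tendsto _).comp hκ).eventually_ne hne)).exists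
      exact h2 h1
    rw [hβ, h] at hre
    push_cast at hre
    have hr : ((g 0)⁻¹).re = x₀ * α := by
      linear_combination x₀ * hre - ((g 0)⁻¹).re * hx₀sq
    refine ⟨m, x₀ * α, hmer, hord, ?_, Or.inl ⟨h, ?_⟩⟩
    · convert hκ
      apply Complex.ext
      · rw [hr, Complex.ofReal_re]
      · rw [him, Complex.ofReal_im]
    · rcases hx₀or with h | h <;> simp [h]
  · exfalso
    obtain ⟨n, hn⟩ := Int.eq_ofNat_of_zero_le (show 0 ≤ m - 1 by omega)
    have hn0 : 0 < n := by omega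
    -- the direction in which `w / k w` is positive up to the sign `x₀`
    obtain ⟨e, he⟩ := IsAlgClosed.exists_pow_nat_eq ((x₀ : ℂ) * ‖g 0‖ / g 0) hn0
    have he1 : ‖e‖ = 1 := by
      have h1 : ‖e‖ ^ n = 1 := by
        rw [← norm_pow, he, norm_div, norm_mul, Complex.norm_real, Complex.norm_real, norm_norm,
          Real.norm_eq_abs, hx₀abs, one_mul, div_self (norm_ne_zero_iff.2 hg0)]
      exact (pow_eq_one_iff_of_nonneg (norm_nonneg e) hn0.ne').1 h1
    have he0 : e ≠ 0 := norm_ne_zero_iff.1 (by rw [he1]; exact one_ne_zero)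
    have hray := tendsto_ofReal_mul_nhdsNE he0
    have h1 : Tendsto (fun r : ℝ => x (r * e) * ((e ^ n)⁻¹ * (g (r * e))⁻¹).re) (𝓝[>] 0)
        (𝓝 (x₀ * ((e ^ n)⁻¹ * (g 0)⁻¹).re)) :=
      (hx₀.comp hray).mul ((Complex.continuous_re.tendsto _).comp ((hginv.comp hray).const_mul _))
    have h2 : x₀ * ((e ^ n)⁻¹ * (g 0)⁻¹).re = ‖g 0‖⁻¹ := by
      have h3 : (x₀ : ℂ) ≠ 0 := by
        have : x₀ ≠ 0 := by
          rintro rfl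
          simp at hx₀sq
        exact_mod_cast this
      have h4 : (‖g 0‖ : ℂ) ≠ 0 := by exact_mod_cast norm_ne_zero_iff.2 hg0
      have h5 : (e ^ n)⁻¹ * (g 0)⁻¹ = ((x₀ * ‖g 0‖)⁻¹ : ℝ) := by
        rw [he]
        push_cast
        field_simp
      rw [h5, Complex.ofReal_re, mul_inv]
      have : x₀ ≠ 0 := by exact_mod_cast h3
      field_simp
    rw [h2] at h1
    have h3 : Tendsto (fun r : ℝ => (r ^ n)⁻¹) (𝓝[>] 0) atTop := by
      have := (tendsto_pow_atTop hn0.ne').comp (tendsto_inv_nhdsGT_zero (𝕜 := ℝ))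
      refine this.congr fun r => ?_
      simp
    have h4 := h3.atTop_mul_pos (inv_pos.2 (norm_pos_iff.2 hg0)) h1
    have h5 : ∀ᶠ r : ℝ in 𝓝[>] 0, (r ^ n)⁻¹ * (x (r * e) * ((e ^ n)⁻¹ * (g (r * e))⁻¹).re)
        = x (r * e) * (r * e / k (r * e)).re := by
      filter_upwards [hray.eventually hquot] with r hr
      rw [hr, show 1 - m = -(n : ℤ) by omega, zpow_neg, zpow_natCast, mul_pow, mul_inv, mul_assoc,
        ← Complex.ofReal_pow, ← Complex.ofReal_inv, Complex.re_ofReal_mul]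
      ring
    obtain ⟨r, h6, h7, h8⟩ := ((IsRotationFieldAt.frequently_ray hrot hk hA hlen he1
      one_pos).and_eventually (h5.and (h4.eventually_gt_atTop (β + 1)))).exists
    rw [h7] at h8
    linarith [(abs_lt.1 h6).2]

end

/-! ### Meromorphic vector fields on the sphere -/

/-- Liouville's theorem for a meromorphic function on the plane whose singularities are removable and
which has a limit at infinity. -/
theorem eventuallyEq_const_of_tendsto_comp_inv {F : ℂ → ℂ} {ℓ : ℂ} (hF : Meromorphic F)
    (hord : ∀ z, 0 ≤ meromorphicOrderAt F z)
    (hlim : Tendsto (fun w => F w⁻¹) (𝓝[≠] 0) (𝓝 ℓ)) (z : ℂ) :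
    F =ᶠ[𝓝[≠] z] fun _ => ℓ := by
  have hF' : MeromorphicOn F univ := fun z _ => hF z
  set G := toMeromorphicNFOn F univ
  have hFG : ∀ z, F =ᶠ[𝓝[≠] z] G := fun z => (hF'.toMeromorphicNFOn_eq_self_on_nhdsNE (mem_univ z)).symm
  have hG : ∀ z, AnalyticAt ℂ G z := fun z => by
    refine ((meromorphicNFOn_toMeromorphicNFOn F univ
      (mem_univ z)).meromorphicOrderAt_nonneg_iff_analyticAt).1 ?_
    rw [← meromorphicOrderAt_congr (hFG z)]
    exact hord z
  have hFinf : Tendsto F (cocompact ℂ) (𝓝 ℓ) := by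
    rw [← Metric.cobounded_eq_cocompact]
    have : Tendsto (fun w : ℂ => w⁻¹) (Bornology.cobounded ℂ) (𝓝[≠] 0) := Filter.inv_cobounded₀.le
    simpa [Function.comp_def] using hlim.comp this
  have hGinf : Tendsto G (cocompact ℂ) (𝓝 ℓ) := by
    rw [(closed_nhds_basis ℓ).tendsto_right_iff]
    rintro V ⟨hV, hVc⟩
    have h1 := hFinf.eventually hV
    rw [← Metric.cobounded_eq_cocompact] at h1 ⊢
    obtain ⟨R, -, hR⟩ := (Metric.hasBasis_cobounded_compl_closedBall (0 : ℂ)).eventually_iff.1 h1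
    refine (Metric.hasBasis_cobounded_compl_closedBall (0 : ℂ)).eventually_iff.2
      ⟨R, trivial, fun z hz => ?_⟩
    refine hVc.mem_of_tendsto ((hG z).continuousAt.tendsto.mono_left nhdsWithin_le_nhds)
      (b := 𝓝[≠] z) ?_
    have h2 : ∀ᶠ w in 𝓝[≠] z, w ∈ (Metric.closedBall (0 : ℂ) R)ᶜ :=
      nhdsWithin_le_nhds (Metric.isClosed_closedBall.isOpen_compl.mem_nhds hz)
    filter_upwards [h2, hFG z] with w hw hw'
    rw [← hw']
    exact hR hw
  have hGc : Differentiable ℂ G := fun z => (hG z).differentiableAt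
  filter_upwards [hFG z] with w hw
  rw [hw]
  exact hGc.apply_eq_of_tendsto_cocompact w hGinf

/-- The component of the vector field `k(z) ∂/∂z` in the coordinate `w = 1 / z`; since
`dw / dz = -w ^ 2`, it is `-w ^ 2 * k (1 / w)`. -/
noncomputable def fieldAtInfty (k : ℂ → ℂ) (w : ℂ) : ℂ := -w ^ 2 * k w⁻¹

section

variable {k : ℂ → ℂ} {m : ℂ → ℤ} {r : ℂ → ℂ} {m' : ℤ} {r' : ℂ}

theorem eq_fieldAtInfty {w : ℂ} (hw : w ≠ 0) : k w = -w ^ 2 * fieldAtInfty k w⁻¹ := by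
  unfold fieldAtInfty
  rw [inv_inv]
  field_simp

theorem finite_setOf_order_ne_zero (hk : Meromorphic k)
    (hm : ∀ z, meromorphicOrderAt k z = m z) (hinf : MeromorphicAt (fieldAtInfty k) 0)
    (hm' : meromorphicOrderAt (fieldAtInfty k) 0 = m') : {z | m z ≠ 0}.Finite := by
  have h1 : ∀ᶠ w in 𝓝[≠] 0, AnalyticAt ℂ (fieldAtInfty k) w ∧ fieldAtInfty k w ≠ 0 :=
    hinf.eventually_analyticAt.and ((meromorphicOrderAt_ne_top_iff_eventually_ne_zero hinf).1
      (by rw [hm']; exact WithTop.coe_ne_top))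
  rw [← Filter.inv_cobounded₀] at h1
  have h1' : ∀ᶠ z in Bornology.cobounded ℂ,
      AnalyticAt ℂ (fieldAtInfty k) z⁻¹ ∧ fieldAtInfty k z⁻¹ ≠ 0 := h1
  obtain ⟨R, -, hR⟩ := (Metric.hasBasis_cobounded_compl_closedBall (0 : ℂ)).eventually_iff.1
    (h1'.and (Bornology.eventually_ne_cobounded 0))
  have hmer : MeromorphicOn k (Metric.closedBall 0 R) := fun z _ => hk z
  refine ((MeromorphicOn.divisor k (Metric.closedBall 0 R)).finiteSupport
    (isCompact_closedBall 0 R)).subset fun z hz => ?_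
  by_cases hzR : z ∈ Metric.closedBall (0 : ℂ) R
  · rw [Function.mem_support, MeromorphicOn.divisor_apply hmer hzR, hm]
    exact hz
  · obtain ⟨⟨h2, h3⟩, h4⟩ := hR hzR
    have h5 : AnalyticAt ℂ (fun w => -w ^ 2 * fieldAtInfty k w⁻¹) z :=
      ((analyticAt_id.pow 2).neg).mul (h2.comp (analyticAt_inv h4))
    have h6 : k =ᶠ[𝓝[≠] z] fun w => -w ^ 2 * fieldAtInfty k w⁻¹ := by
      filter_upwards [nhdsWithin_le_nhds (isOpen_ne.mem_nhds h4)] with w hw using eq_fieldAtInfty hw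
    have h7 : meromorphicOrderAt k z = 0 := by
      rw [meromorphicOrderAt_congr h6, ← tendsto_ne_zero_iff_meromorphicOrderAt_eq_zero
        h5.meromorphicAt]
      exact ⟨_, mul_ne_zero (neg_ne_zero.2 (pow_ne_zero 2 h4)) h3,
        h5.continuousAt.tendsto.mono_left nhdsWithin_le_nhds⟩
    rw [hm] at h7
    exact absurd (by exact_mod_cast h7) hz

theorem meromorphicOrderAt_zpow_sub (u z : ℂ) (n : ℤ) :
    meromorphicOrderAt (fun w => (w - u) ^ n) z = ((if z = u then n else 0 : ℤ) : WithTop ℤ) := by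
  split_ifs with h
  · subst h
    exact fun_meromorphicOrderAt_zpow_id_sub_const
  · have h0 : z - u ≠ 0 := sub_ne_zero.2 h
    have h1 : AnalyticAt ℂ (fun w => (w - u) ^ n) z := (analyticAt_id.sub analyticAt_const).zpow h0
    exact (tendsto_ne_zero_iff_meromorphicOrderAt_eq_zero h1.meromorphicAt).1
      ⟨_, zpow_ne_zero n h0, h1.continuousAt.tendsto.mono_left nhdsWithin_le_nhds⟩

/-- A meromorphic vector field on the sphere has two more zeros than poles. -/
theorem sum_order_eq_two (hk : Meromorphic k)
    (hm : ∀ z, meromorphicOrderAt k z = m z) (hinf : MeromorphicAt (fieldAtInfty k) 0)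
    (hm' : meromorphicOrderAt (fieldAtInfty k) 0 = m') {T : Finset ℂ} (hT : ∀ z ∉ T, m z = 0) :
    ∑ z ∈ T, m z + m' = 2 := by
  -- dividing out all finite zeros and poles leaves a function whose only zero or pole is at infinity
  set F : ℂ → ℂ := fun z => k z * ∏ u ∈ T, (z - u) ^ (-m u) with hFdef
  have hfac : ∀ u z, MeromorphicAt (fun w : ℂ => (w - u) ^ (-m u)) z := fun u z =>
    ((MeromorphicAt.id z).sub (MeromorphicAt.const u z)).zpow _
  have hF : Meromorphic F := fun z => (hk z).mul (MeromorphicAt.fun_prod fun u _ => hfac u z)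
  have hF0 : ∀ z, meromorphicOrderAt F z = 0 := fun z => by
    rw [hFdef, fun_meromorphicOrderAt_mul (hk z) (MeromorphicAt.fun_prod fun u _ => hfac u z),
      meromorphicOrderAt_fun_prod fun u _ => hfac u z, hm]
    simp_rw [meromorphicOrderAt_zpow_sub]
    norm_cast
    rw [Finset.sum_ite_eq]
    split_ifs with h
    · simp
    · simp [hT z h]
  set d : ℤ := m' - 2 + ∑ u ∈ T, m u with hd
  have hH : (fun w => F w⁻¹) =ᶠ[𝓝[≠] 0]
      fun w => (fieldAtInfty k w * (-(w - 0) ^ (-2 : ℤ))) *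
        ∏ u ∈ T, ((w - 0) ^ m u * (1 - u * w) ^ (-m u)) := by
    filter_upwards [self_mem_nhdsWithin] with w hw
    have hw' : w ≠ 0 := hw
    simp only [hFdef, sub_zero]
    congr 1
    · rw [fieldAtInfty, zpow_neg]
      field_simp
    · refine Finset.prod_congr rfl fun u _ => ?_
      rw [show w⁻¹ - u = w⁻¹ * (1 - u * w) by field_simp, mul_zpow, inv_zpow, zpow_neg, inv_inv]
  have hHmer1 : MeromorphicAt (fun w : ℂ => -(w - 0) ^ (-2 : ℤ)) 0 :=
    (((MeromorphicAt.id 0).sub (MeromorphicAt.const 0 0)).zpow _).neg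
  have hz1 : ∀ u, MeromorphicAt (fun w : ℂ => (w - 0) ^ m u) 0 := fun u =>
    ((MeromorphicAt.id 0).sub (MeromorphicAt.const 0 0)).zpow _
  have hz2 : ∀ u, AnalyticAt ℂ (fun w : ℂ => (1 - u * w) ^ (-m u)) 0 := fun u =>
    (analyticAt_const.sub (analyticAt_const.mul analyticAt_id)).zpow (by simp)
  have hz3 : ∀ u, meromorphicOrderAt (fun w : ℂ => (1 - u * w) ^ (-m u)) 0 = 0 := fun u =>
    (tendsto_ne_zero_iff_meromorphicOrderAt_eq_zero (hz2 u).meromorphicAt).1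
      ⟨_, by simp, (hz2 u).continuousAt.tendsto.mono_left nhdsWithin_le_nhds⟩
  have hz4 : ∀ u ∈ T, MeromorphicAt (fun w : ℂ => (w - 0) ^ m u * (1 - u * w) ^ (-m u)) 0 :=
    fun u _ => (hz1 u).mul (hz2 u).meromorphicAt
  have hHmer2 : MeromorphicAt (fun w => fieldAtInfty k w * -(w - 0) ^ (-2 : ℤ)) 0 :=
    hinf.mul hHmer1
  have hHord : meromorphicOrderAt (fun w => F w⁻¹) 0 = d := by
    rw [meromorphicOrderAt_congr hH, fun_meromorphicOrderAt_mul hHmer2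
      (MeromorphicAt.fun_prod hz4), fun_meromorphicOrderAt_mul hinf hHmer1,
      meromorphicOrderAt_fun_prod hz4,
      ← meromorphicOrderAt_fun_neg (f := fun w : ℂ => (w - 0) ^ (-2 : ℤ)), hm',
      meromorphicOrderAt_zpow_sub]
    have : ∀ u, meromorphicOrderAt (fun w : ℂ => (w - 0) ^ m u * (1 - u * w) ^ (-m u)) 0 = m u :=
      fun u => by
        rw [fun_meromorphicOrderAt_mul (hz1 u) (hz2 u).meromorphicAt, hz3,
          meromorphicOrderAt_zpow_sub]
        simp
    simp_rw [this]
    rw [if_pos trivial]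
    norm_cast
  rcases lt_trichotomy d 0 with h | h | h
  · exfalso
    have h1 := eventuallyEq_const_of_tendsto_comp_inv (F := F⁻¹) (ℓ := 0) (fun z => (hF z).inv)
      (fun z => by rw [meromorphicOrderAt_inv, hF0]; simp)
      (tendsto_zero_of_meromorphicOrderAt_pos (f := (fun w => F w⁻¹)⁻¹)
        (by rw [meromorphicOrderAt_inv, hHord]; exact_mod_cast neg_pos.2 h)) 0
    have h2 : meromorphicOrderAt F⁻¹ 0 = ⊤ := meromorphicOrderAt_eq_top_iff.2 h1
    rw [meromorphicOrderAt_inv, hF0] at h2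
    exact absurd h2 (by decide)
  · omega
  · exfalso
    have h1 := eventuallyEq_const_of_tendsto_comp_inv (F := F) (ℓ := 0) hF
      (fun z => (hF0 z).ge) (tendsto_zero_of_meromorphicOrderAt_pos
        (by rw [hHord]; exact_mod_cast h)) 0
    have h2 : meromorphicOrderAt F 0 = ⊤ := meromorphicOrderAt_eq_top_iff.2 h1
    rw [hF0] at h2
    exact absurd h2 (by decide)

/-- The residue theorem for the form `dz / k` on the sphere, in the case of simple poles. Here `r z` is
the residue at `z`, and `r'` is the residue at infinity, expressed in the coordinate `1 / z`. -/
theorem sum_residue_eq_zero (hk : Meromorphic k)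
    (hr : ∀ z, Tendsto (fun w => (w - z) / k w) (𝓝[≠] z) (𝓝 (r z)))
    (hr' : Tendsto (fun w => w / fieldAtInfty k w) (𝓝[≠] 0) (𝓝 r'))
    {T : Finset ℂ} (hT : ∀ z ∉ T, r z = 0) :
    ∑ z ∈ T, r z + r' = 0 := by
  -- the dual form minus its principal parts is entire and tends to `0` at infinity
  set E : ℂ → ℂ := fun z => (k z)⁻¹ - ∑ u ∈ T, r u / (z - u) with hE
  have hfrac : ∀ u z, MeromorphicAt (fun w : ℂ => r u / (w - u)) z := fun u z =>
    (MeromorphicAt.const _ z).div ((MeromorphicAt.id z).sub (MeromorphicAt.const u z))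
  have hEm : Meromorphic E := fun z =>
    (hk z).inv.sub (MeromorphicAt.fun_sum fun u _ => hfrac u z)
  have hEord : ∀ z, 0 ≤ meromorphicOrderAt E z := fun z => by
    have h1 : MeromorphicAt (fun w : ℂ => w - z) z :=
      (MeromorphicAt.id z).sub (MeromorphicAt.const z z)
    have h2 : Tendsto (fun w => (w - z) * E w) (𝓝[≠] z) (𝓝 0) := by
      have h3 : ∀ u ∈ T, Tendsto (fun w : ℂ => (w - z) * (r u / (w - u))) (𝓝[≠] z)
          (𝓝 (if z = u then r u else 0)) := fun u _ => by
        split_ifs with h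
        · subst h
          refine tendsto_const_nhds.congr' ?_
          filter_upwards [self_mem_nhdsWithin] with w hw
          have : w - z ≠ 0 := sub_ne_zero.2 hw
          field_simp
        · have h0 : z - u ≠ 0 := sub_ne_zero.2 h
          have : ContinuousAt (fun w : ℂ => (w - z) * (r u / (w - u))) z := by fun_prop (disch := assumption)
          simpa using this.tendsto.mono_left nhdsWithin_le_nhds
      have h4 := (hr z).sub (tendsto_finsetSum T h3)
      rw [Finset.sum_ite_eq] at h4
      have h5 : (r z - if z ∈ T then r z else 0) = 0 := by
        split_ifs with h
        · simp
        · simp [hT z h]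
      rw [h5] at h4
      refine h4.congr fun w => ?_
      simp only [hE]
      rw [mul_sub, Finset.mul_sum, div_eq_mul_inv]
    have h3 := (tendsto_zero_iff_meromorphicOrderAt_pos (h1.mul (hEm z))).1 h2
    rw [meromorphicOrderAt_mul h1 (hEm z)] at h3
    rw [meromorphicOrderAt_id_sub_const] at h3
    cases h : meromorphicOrderAt E z with
    | top => exact le_top
    | coe n =>
      rw [h] at h3
      norm_cast at h3 ⊢
      omega
  have hlim : Tendsto (fun w => E w⁻¹ / w) (𝓝[≠] 0) (𝓝 (-r' - ∑ u ∈ T, r u)) := by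
    have h1 : ∀ u ∈ T, Tendsto (fun w : ℂ => r u / (1 - u * w)) (𝓝[≠] 0) (𝓝 (r u)) := fun u _ => by
      have h0 : (1 : ℂ) - u * 0 ≠ 0 := by simp
      have : ContinuousAt (fun w : ℂ => r u / (1 - u * w)) 0 := by fun_prop (disch := assumption)
      simpa using this.tendsto.mono_left (nhdsWithin_le_nhds (s := {0}ᶜ))
    refine (hr'.neg.sub (tendsto_finsetSum T h1)).congr' ?_
    filter_upwards [self_mem_nhdsWithin] with w hw
    have hw' : w ≠ 0 := hw
    simp only [hE]
    rw [sub_div, Finset.sum_div]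
    congr 1
    · rw [fieldAtInfty]
      field_simp
    · refine Finset.sum_congr rfl fun u _ => ?_
      rw [div_div, show (w⁻¹ - u) * w = 1 - u * w by field_simp]
  have hE0 := eventuallyEq_const_of_tendsto_comp_inv (ℓ := 0) hEm hEord (by
    have h1 : Tendsto (fun w : ℂ => w) (𝓝[≠] 0) (𝓝 0) := tendsto_id.mono_left nhdsWithin_le_nhds
    have h2 := h1.mul hlim
    rw [zero_mul] at h2
    refine h2.congr' ?_
    filter_upwards [self_mem_nhdsWithin] with w hw
    exact mul_div_cancel₀ _ hw)
  by_contra hne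
  have hne' : -r' - ∑ u ∈ T, r u ≠ 0 := fun h => hne (by linear_combination -h)
  obtain ⟨w, h1, h2⟩ := (((eventually_eventually_nhdsNE (hlim.eventually_ne hne')).filter_mono
    (nhdsWithin_le_nhds (s := {0}ᶜ))).and self_mem_nhdsWithin).exists
  have h2' : w ≠ 0 := h2
  have h3 : Tendsto (fun v : ℂ => v⁻¹) (𝓝[≠] w) (𝓝[≠] w⁻¹) :=
    (hasDerivAt_inv h2').tendsto_nhdsNE (by simpa using h2')
  obtain ⟨v, h4, h5⟩ := (h1.and (h3.eventually (hE0 w⁻¹))).exists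
  exact h4 (by rw [h5, zero_div])

end

/-! ### Arithmetic of the angles -/

/-- The arithmetic of the orders `m j` and residues `r j` of the rotation field at the cone points.
The nonsingular points contribute `N`, the number of fixed points of the rotation field among them,
and `M`, the sum of their residues `±1`. -/
theorem angle_relations {n : ℕ} (hn0 : n ≠ 0) (hn2 : n ≠ 2) {α : Fin n → ℝ} (hα : ∀ j, 0 < α j)
    {m : Fin n → ℤ} {r : Fin n → ℝ} {N M : ℤ}
    (h : ∀ j, (m j = 1 ∧ (r j = α j ∨ r j = -α j)) ∨ ((m j : ℝ) = 1 - α j ∧ r j = 0))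
    (hMN : |M| ≤ N) (hdvd : 2 ∣ N - M) (hm : ∑ j, m j + N = 2) (hr : ∑ j, r j + M = 0) :
    (integerAngles α).Nonempty ∧
    ∃ (ε : Fin n → ℤ) (k' : ℕ) (s : ℤ),
      (∀ j, ε j = 1 ∨ ε j = -1) ∧
      ∑ j ∈ (integerAngles α)ᶜ, (ε j : ℝ) * α j = (k' : ℝ) ∧
      ∑ j ∈ integerAngles α, α j = (s : ℝ) ∧
      (n : ℤ) + (k' : ℤ) - 2 ≤ s ∧
      s ≡ (n : ℤ) + (k' : ℤ) [ZMOD 2] := by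
  set S := integerAngles α with hS
  have hmem : ∀ j, j ∈ S ↔ ∃ k : ℤ, α j = k := fun j => by simp [hS, integerAngles]
  -- at an integral angle `A`, the residue `q` has the parity of `A - 1 + m` and is bounded by it,
  -- because `A - 1 + m` is `A` if `q = ±A` and `0` if `q = 0`
  have hloc : ∀ j, ∃ ε A q : ℤ, (ε = 1 ∨ ε = -1) ∧ (j ∉ S → m j = 1 ∧ r j = ε * α j) ∧
      (j ∈ S → α j = A ∧ r j = q ∧ |q| ≤ A - 1 + m j ∧ 2 ∣ (A - 1 + m j) - q) := by
    intro j
    by_cases hj : j ∈ S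
    · obtain ⟨A, hA⟩ := (hmem j).1 hj
      have hA0 : 0 < A := by
        have := hα j
        rw [hA] at this
        exact_mod_cast this
      rcases h j with ⟨h1, h2 | h2⟩ | ⟨h1, h2⟩
      · exact ⟨1, A, A, Or.inl rfl, fun h => absurd hj h, fun _ =>
          ⟨hA, h2.trans hA, by rw [h1, abs_of_pos hA0]; omega, by rw [h1]; simp⟩⟩
      · exact ⟨1, A, -A, Or.inl rfl, fun h => absurd hj h, fun _ =>
          ⟨hA, by rw [h2, hA]; simp, by rw [h1, abs_neg, abs_of_pos hA0]; omega, by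
            rw [h1]; omega⟩⟩
      · have h3 : m j = 1 - A := by
          rw [hA] at h1
          exact_mod_cast h1
        exact ⟨1, A, 0, Or.inl rfl, fun h => absurd hj h, fun _ =>
          ⟨hA, by rw [h2]; simp, by rw [h3, abs_zero]; omega, by rw [h3]; simp⟩⟩
    · rcases h j with ⟨h1, h2 | h2⟩ | ⟨h1, h2⟩
      · exact ⟨1, 0, 0, Or.inl rfl, fun _ => ⟨h1, by simp [h2]⟩, fun h => absurd h hj⟩
      · exact ⟨-1, 0, 0, Or.inr rfl, fun _ => ⟨h1, by simp [h2]⟩, fun h => absurd h hj⟩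
      · exact absurd ((hmem j).2 ⟨1 - m j, by push_cast; linarith⟩) hj
  choose ε A q hε hnon hint using hloc
  have hsumm : ∑ j ∈ S, m j + (Sᶜ.card : ℤ) + N = 2 := by
    rw [← Finset.sum_add_sum_compl S, Finset.sum_congr (s₁ := Sᶜ) rfl fun j hj =>
      (hnon j (Finset.mem_compl.1 hj)).1] at hm
    simpa using hm
  have hcard : (S.card : ℤ) + Sᶜ.card = n := by
    exact_mod_cast (Finset.card_add_card_compl S).trans (Fintype.card_fin n)
  have hsumr : ∑ j ∈ Sᶜ, (ε j : ℝ) * α j = ((-(∑ j ∈ S, q j + M) : ℤ) : ℝ) := by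
    rw [← Finset.sum_add_sum_compl S, Finset.sum_congr (s₁ := Sᶜ) rfl fun j hj =>
      (hnon j (Finset.mem_compl.1 hj)).2, Finset.sum_congr (s₁ := S) rfl fun j hj =>
      (hint j hj).2.1] at hr
    push_cast
    linarith
  set κ : ℤ := -(∑ j ∈ S, q j + M) with hκ
  have hb : ∑ j ∈ S, (A j - 1 + m j) = ∑ j ∈ S, A j - n + 2 - N := by
    rw [Finset.sum_add_distrib, Finset.sum_sub_distrib]
    simp only [Finset.sum_const, nsmul_eq_mul, mul_one]
    linarith
  have hκle : |κ| ≤ ∑ j ∈ S, A j - n + 2 := by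
    have h1 : |∑ j ∈ S, q j| ≤ ∑ j ∈ S, (A j - 1 + m j) :=
      (Finset.abs_sum_le_sum_abs _ _).trans (Finset.sum_le_sum fun j hj => (hint j hj).2.2.1)
    rw [hκ, abs_neg]
    linarith [abs_add_le (∑ j ∈ S, q j) M]
  have hκdvd : 2 ∣ (∑ j ∈ S, A j - n + 2) - κ := by
    have h1 : 2 ∣ ∑ j ∈ S, ((A j - 1 + m j) - q j) :=
      Finset.dvd_sum fun j hj => (hint j hj).2.2.2
    rw [Finset.sum_sub_distrib, hb] at h1
    omega
  refine ⟨?_, ?_⟩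
  -- without integral angles `n + N = 2`, so that `n = 1` and the only angle would be an integer
  · rw [Finset.nonempty_iff_ne_empty]
    intro hempty
    rw [hempty] at hsumm hcard hsumr
    simp only [Finset.sum_empty, Finset.card_empty, Finset.compl_empty] at hsumm hcard hsumr
    have hN : 0 ≤ N := (abs_nonneg M).trans hMN
    obtain rfl : n = 1 := by
      simp at hsumm
      omega
    have h0 : (0 : Fin 1) ∈ S := by
      rw [hmem]
      simp only [Finset.univ_unique, Fin.default_eq_zero, Finset.sum_singleton] at hsumr
      rcases hε 0 with h | h
      · exact ⟨κ, by rw [← hsumr, h]; simp⟩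
      · refine ⟨-κ, ?_⟩
        rw [Int.cast_neg, ← hsumr, h]
        simp
    rw [hempty] at h0
    exact absurd h0 (Finset.notMem_empty _)
  · have hs : ∑ j ∈ S, α j = ((∑ j ∈ S, A j : ℤ) : ℝ) := by
      rw [Finset.sum_congr rfl fun j hj => (hint j hj).1]
      push_cast
      rfl
    rcases le_total 0 κ with h0 | h0
    · rw [abs_of_nonneg h0] at hκle
      refine ⟨ε, κ.toNat, ∑ j ∈ S, A j, hε, ?_, hs, by omega, ?_⟩
      · rw [hsumr]
        exact_mod_cast (Int.toNat_of_nonneg h0).symm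
      · rw [Int.toNat_of_nonneg h0]
        exact (Int.modEq_iff_dvd.2 (by omega)).symm
    · rw [abs_of_nonpos h0] at hκle
      refine ⟨fun j => -ε j, (-κ).toNat, ∑ j ∈ S, A j, fun j => ?_, ?_, hs, by omega, ?_⟩
      · rcases hε j with h | h <;> simp [h]
      · push_cast
        simp_rw [neg_mul]
        rw [Finset.sum_neg_distrib, hsumr]
        have := Int.toNat_of_nonneg (neg_nonneg.2 h0)
        exact_mod_cast this.symm
      · rw [Int.toNat_of_nonneg (neg_nonneg.2 h0)]
        exact (Int.modEq_iff_dvd.2 (by omega)).symm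

/-! ### Local and global analysis combined -/

/-- The component of the vector field `k(z) ∂/∂z` in the coordinate `sphereCoord p`. -/
noncomputable def localField (k : ℂ → ℂ) : OnePoint ℂ → ℂ → ℂ
  | OnePoint.infty => fieldAtInfty k
  | OnePoint.some z => fun w => k (z + w)

theorem IsRotationFieldAt.comp_const_add {ρ x : ℂ → ℝ} {k : ℂ → ℂ} {z w : ℂ}
    (h : IsRotationFieldAt ρ k x (z + w)) :
    IsRotationFieldAt (fun v => ρ (z + v)) (fun v => k (z + v)) (fun v => x (z + v)) w := by
  have hd : ∀ v : ℂ, deriv (fun v => z + v) v = 1 := fun v => by simp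
  have := h.comp (τ := fun v => z + v) (by fun_prop) (by rw [hd]; exact one_ne_zero)
  simpa only [hd, norm_one, mul_one, div_one] using this

theorem IsRotationFieldAt.fieldAtInfty {ρ ρ' x : ℂ → ℝ} {k : ℂ → ℂ} {w : ℂ} (hw : w ≠ 0)
    (h : IsRotationFieldAt ρ k x w⁻¹) (hρ : ρ' w = ρ w⁻¹ / ‖w‖ ^ 2) :
    IsRotationFieldAt ρ' (_root_.fieldAtInfty k) (fun v => x v⁻¹) w := by
  have := h.comp (τ := fun v => v⁻¹) (analyticAt_inv hw) (by simpa using hw)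
  refine this.congr ?_ ?_ EventuallyEq.rfl
  · rw [hρ, deriv_inv, norm_neg, norm_inv, norm_pow]
    rfl
  · filter_upwards [isOpen_ne.mem_nhds hw] with v hv
    have hv' : v ≠ 0 := hv
    rw [deriv_inv, _root_.fieldAtInfty]
    field_simp

theorem eventually_nhdsNE_notMem {P : Set (OnePoint ℂ)} (hP : P.Finite) (p : OnePoint ℂ) :
    ∀ᶠ w in 𝓝[≠] (0 : ℂ), sphereCoord p w ∉ P := by
  have h1 : ∀ᶠ q in 𝓝[≠] p, q ∉ P := by
    have h2 : (P \ {p})ᶜ ∈ 𝓝 p := (hP.subset sdiff_subset).isClosed.isOpen_compl.mem_nhds (by simp)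
    filter_upwards [nhdsWithin_le_nhds h2, self_mem_nhdsWithin] with q h3 h4 h5
    exact h3 ⟨h5, h4⟩
  rwa [← map_sphereCoord_nhdsNE, eventually_map] at h1

theorem exists_localField_isRotationFieldAt {g : ConformalMetric} {P : Set (OnePoint ℂ)}
    (hP : P.Finite) {k : ℂ → ℂ} {x : ℂ → ℝ}
    (h : ∀ z : ℂ, (z : OnePoint ℂ) ∉ P → IsRotationFieldAt g.dens k x z) (p : OnePoint ℂ) :
    ∃ y, ∀ᶠ w in 𝓝[≠] 0, IsRotationFieldAt (g.localDens p) (localField k p) y w := by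
  have hnot := eventually_nhdsNE_notMem hP p
  induction p using OnePoint.rec with
  | infty =>
    refine ⟨fun w => x w⁻¹, ?_⟩
    filter_upwards [hnot, self_mem_nhdsWithin] with w h1 h2
    have h2' : w ≠ 0 := h2
    have h3 : sphereCoord OnePoint.infty w = ((w⁻¹ : ℂ) : OnePoint ℂ) := by
      simp only [sphereCoord]
      exact if_neg h2'
    rw [h3] at h1
    exact (h _ h1).fieldAtInfty h2' (g.compat w h2')
  | coe z =>
    refine ⟨fun w => x (z + w), ?_⟩
    filter_upwards [hnot] with w h1
    exact (h _ h1).comp_const_add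

/-- The local analysis and the two global relations, put together. The finite set `T` contains all
zeros and poles of the field, and both sums include the point at infinity. -/
theorem exists_orders {g : ConformalMetric} {P : Set (OnePoint ℂ)} (hP : P.Finite)
    {k : ℂ → ℂ} {x : ℂ → ℝ}
    (h : ∀ z : ℂ, (z : OnePoint ℂ) ∉ P → IsRotationFieldAt g.dens k x z) {α : OnePoint ℂ → ℝ}
    (hα : ∀ p, 0 < α p) (hcone : ∀ p, ∃ c, 0 < c ∧
      Tendsto (fun w : ℂ => g.localDens p w / ‖w‖ ^ (α p - 1)) (𝓝[≠] 0) (𝓝 c)) :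
    ∃ (m : OnePoint ℂ → ℤ) (r : OnePoint ℂ → ℝ) (T : Finset (OnePoint ℂ)), P ⊆ T ∧
      (∀ p, (m p = 1 ∧ (r p = α p ∨ r p = -α p)) ∨ ((m p : ℝ) = 1 - α p ∧ r p = 0)) ∧
      ∑ p ∈ T, m p = 2 ∧ ∑ p ∈ T, r p = 0 := by
  have hex : ∀ p, ∃ (m : ℤ) (r : ℝ), MeromorphicAt (localField k p) 0 ∧
      meromorphicOrderAt (localField k p) 0 = m ∧
      Tendsto (fun w => w / localField k p w) (𝓝[≠] 0) (𝓝 (r : ℂ)) ∧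
      ((m = 1 ∧ (r = α p ∨ r = -α p)) ∨ ((m : ℝ) = 1 - α p ∧ r = 0)) := fun p => by
    obtain ⟨c, hc, hlim⟩ := hcone p
    obtain ⟨y, hy⟩ := exists_localField_isRotationFieldAt hP h p
    exact IsRotationFieldAt.exists_order (hα p) hc hlim hy
  choose m r hmer hord hlim halt using hex
  have hcomp : ∀ z : ℂ, localField k z = k ∘ (· + z) := fun z => by
    funext w
    exact congrArg k (add_comm z w)
  have hk : Meromorphic k := fun z => by
    have := hmer z
    rwa [hcomp, meromorphicAt_comp_add_const_iff_meromorphicAt, zero_add] at this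
  have hm : ∀ z : ℂ, meromorphicOrderAt k z = m z := fun z => by
    have := hord z
    rwa [hcomp, meromorphicOrderAt_comp_add_const_eq_meromorphicOrderAt, zero_add] at this
  have hr : ∀ z : ℂ, Tendsto (fun w => (w - z) / k w) (𝓝[≠] z) (𝓝 (r z : ℂ)) := fun z => by
    have h1 : 𝓝[≠] z = map (z + ·) (𝓝[≠] (0 : ℂ)) := by simp
    rw [h1, tendsto_map'_iff]
    refine (hlim z).congr fun w => ?_
    simp only [Function.comp_apply, add_sub_cancel_left]
    rfl
  have hfin := finite_setOf_order_ne_zero hk hm (hmer OnePoint.infty) (hord OnePoint.infty)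
  have hPfin : ((fun z : ℂ => (z : OnePoint ℂ)) ⁻¹' P).Finite :=
    hP.preimage OnePoint.coe_injective.injOn
  classical
  set T₀ : Finset ℂ := hfin.toFinset ∪ hPfin.toFinset with hT₀
  have hT₀m : ∀ z ∉ T₀, m z = 0 := fun z hz => by
    simp only [hT₀, Finset.mem_union, not_or, Finite.mem_toFinset, mem_ofPred_eq, not_not] at hz
    exact hz.1
  have hT₀r : ∀ z ∉ T₀, (r z : ℂ) = 0 := fun z hz => by
    rcases halt z with h1 | h1
    · rw [hT₀m z hz] at h1
      exact absurd h1.1 (by decide)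
    · simp [h1.2]
  have hsum1 := sum_order_eq_two hk hm (hmer OnePoint.infty) (hord OnePoint.infty) hT₀m
  have hsum2 := sum_residue_eq_zero hk hr (hlim OnePoint.infty) hT₀r
  refine ⟨m, r, insert (OnePoint.infty : OnePoint ℂ) (T₀.map ⟨_, OnePoint.coe_injective⟩), ?_, halt, ?_, ?_⟩
  · intro p hp
    induction p using OnePoint.rec with
    | infty => simp
    | coe z =>
      refine Finset.mem_coe.2 (Finset.mem_insert_of_mem (Finset.mem_map.2 ⟨z, ?_, rfl⟩))
      exact Finset.mem_union_right _ (hPfin.mem_toFinset.2 hp)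
  · rw [Finset.sum_insert (by simp), Finset.sum_map, add_comm]
    exact hsum1
  · rw [Finset.sum_insert (by simp), Finset.sum_map, add_comm]
    exact_mod_cast hsum2

theorem sum_eq_sum_comp_add_sum_sdiff {M : Type*} [AddCommMonoid M] [DecidableEq (OnePoint ℂ)] {n : ℕ} {a : Fin n → OnePoint ℂ}
    (ha : Function.Injective a) {T : Finset (OnePoint ℂ)} (hT : range a ⊆ T) (f : OnePoint ℂ → M) :
    ∑ p ∈ T, f p = ∑ j, f (a j) + ∑ p ∈ T \ Finset.univ.image a, f p := by
  rw [← Finset.sum_image (f := f) (s := Finset.univ) ha.injOn, add_comm, Finset.sum_sdiff]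
  intro p hp
  obtain ⟨j, -, rfl⟩ := Finset.mem_image.1 hp
  exact hT (mem_range_self j)

theorem mainTheorem4 (n : ℕ) (hn0 : n ≠ 0) (hn2 : n ≠ 2)
    (a : Fin n → OnePoint ℂ) (ha : Function.Injective a)
    (α : Fin n → ℝ) (hα_pos : ∀ j, 0 < α j) (hα_ne : ∀ j, α j ≠ 1)
    (g : ConformalMetric) (hg : IsSphericalConeMetric g a α)
    (hco : IsCoaxial g (Set.range a)) :
    (integerAngles α).Nonempty ∧
    ∃ (ε : Fin n → ℤ) (k' : ℕ) (s : ℤ),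
      (∀ j, ε j = 1 ∨ ε j = -1) ∧
      ∑ j ∈ (integerAngles α)ᶜ, (ε j : ℝ) * α j = (k' : ℝ) ∧
      ∑ j ∈ integerAngles α, α j = (s : ℝ) ∧
      (n : ℤ) + (k' : ℤ) - 2 ≤ s ∧
      s ≡ (n : ℤ) + (k' : ℤ) [ZMOD 2] := by
  have hP : (range a).Finite := finite_range a
  have hdens : ∀ z : ℂ, g.localDens z = fun w => g.dens (z + w) := fun z => rfl
  obtain ⟨k, x, hkx⟩ := hco.exists_isRotationFieldAt hP
    (fun z hz => by simpa [hdens] using hg.pos z hz)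
    (fun z hz => by
      have h1 : ContinuousAt (fun w => g.dens (z + w)) (z - z) := by
        rw [sub_self]
        exact (hg.smooth z hz).continuousAt
      have h2 : ContinuousAt (fun v => g.dens (z + (v - z))) z :=
        ContinuousAt.comp (f := fun v : ℂ => v - z) h1 (by fun_prop)
      simpa using h2)
  -- nonsingular points are cone points of angle `2 π`
  set β : OnePoint ℂ → ℝ := Function.extend a α fun _ => 1 with hβ
  have hβa : ∀ j, β (a j) = α j := fun j => ha.extend_apply _ _ j
  have hβ1 : ∀ p, p ∉ range a → β p = 1 := fun p hp => Function.extend_apply' _ _ _ hp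
  obtain ⟨m, r, T, hT, halt, hm, hr⟩ := exists_orders hP hkx (α := β)
    (fun p => by
      by_cases hp : p ∈ range a
      · obtain ⟨j, rfl⟩ := hp
        rw [hβa]
        exact hα_pos j
      · rw [hβ1 p hp]
        exact one_pos)
    (fun p => by
      by_cases hp : p ∈ range a
      · obtain ⟨j, rfl⟩ := hp
        rw [hβa]
        exact hg.conic j
      · refine ⟨_, hg.pos p hp, ?_⟩
        rw [hβ1 p hp]
        simpa using (hg.smooth p hp).continuousAt.tendsto.mono_left nhdsWithin_le_nhds)
  classical
  rw [sum_eq_sum_comp_add_sum_sdiff ha hT] at hm hr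
  have hrest : ∀ p, ∃ q : ℤ, p ∈ T \ Finset.univ.image a →
      r p = q ∧ |q| ≤ m p ∧ 2 ∣ m p - q := fun p => by
    by_cases hp : p ∈ range a
    · refine ⟨0, fun h => absurd ?_ (Finset.mem_sdiff.1 h).2⟩
      simpa using hp
    have h1 := halt p
    rw [hβ1 p hp] at h1
    rcases h1 with ⟨h2, h3 | h3⟩ | ⟨h2, h3⟩
    · exact ⟨1, fun _ => ⟨by simp [h3], by simp [h2], by simp [h2]⟩⟩
    · exact ⟨-1, fun _ => ⟨by simp [h3], by simp [h2], by simp [h2]⟩⟩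
    · have h4 : m p = 0 := by
        rw [sub_self] at h2
        exact_mod_cast h2
      exact ⟨0, fun _ => ⟨by simp [h3], by simp [h4], by simp [h4]⟩⟩
  choose q hq using hrest
  refine angle_relations hn0 hn2 hα_pos (m := fun j => m (a j)) (r := fun j => r (a j))
    (N := ∑ p ∈ T \ Finset.univ.image a, m p) (M := ∑ p ∈ T \ Finset.univ.image a, q p)
    (fun j => hβa j ▸ halt (a j)) ?_ ?_ hm ?_
  · exact (Finset.abs_sum_le_sum_abs _ _).trans (Finset.sum_le_sum fun p hp => (hq p hp).2.1)
  · rw [← Finset.sum_sub_distrib]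
    exact Finset.dvd_sum fun p hp => (hq p hp).2.2
  · rw [Finset.sum_congr rfl fun p hp => (hq p hp).1] at hr
    exact_mod_cast hr
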